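/- Let $K, d, D \ge 1$ be integers and let $\Delta^{d-1} = \{\beta \in \mathbb{R}^d : \beta_j \ge 0,\ \sum_j \beta_j = 1\}$. Let $P_\beta$ be a fixed exchangeable probability measure (invariant under permutations of the coordinates) on $\Delta^{d-1}$ with $P_\beta \ll \mathcal{H}_{d-1}|_{\Delta^{d-1}}$ ($\mathcal{H}_{d-1}$ is the $(d-1)$-dimensional Hausdorff measure) and $\mathrm{supp}(P_\beta) = \Delta^{d-1}$. Let $\Psi$ be the set of all $\psi = (\boldsymbol\Theta, \pi, \Sigma)$, where $\boldsymbol\Theta = (\Theta_1,\dots,\Theta_K)$ with $\Theta_k = (\theta_{k,1},\dots,\theta_{k,d}) \in \mathbb{R}^{D\times d}$ arbitrary, $\pi_k > 0$, $\sum_k \pi_k = 1$, and $\Sigma = (\sigma_1^2,\dots,\sigma_K^2)$ with $\sigma_k^2 > 0$. For $\psi \in \Psi$ let $P_\psi$ be the probability measure on $\mathbb{R}^D$ with Lebesgue density $$p_\psi(x) = \sum_{k=1}^K \pi_k \int_{\Delta^{d-1}} \phi(x \mid \Theta_k\beta, \sigma_k^2 I)\, dP_\beta(\beta),$$ where $\phi(\cdot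 \mid m, \sigma^2 I)$ is the Gaussian density with mean $m$ and covariance $\sigma^2 I$. For $\psi,\psi' \in \Psi$ define the pseudometric $$d(\psi,\psi') = \min_{\tau\in\mathbb{S}_K} \sum_{k=1}^K \Bigl( d_M(\Theta_k,\Theta'_{\tau(k)}) + |\pi_k - \pi'_{\tau(k)}| + |\sigma_k^2 - \sigma'^2_{\tau(k)}| \Bigr), \qquad d_M(\Theta,\Theta') = \min_{\tau\in\mathbb{S}_d} \sum_{j=1}^d \|\theta_j - \theta'_{\tau(j)}\|.$$ Write $\mathcal{S}_k = \mathrm{conv}(\theta_{k,1},\dots,\theta_{k,d})$. Call $\boldsymbol\Theta$ totally exposed if every $\theta_{k,j}$ ($k \le K$, $j \le d$) is an extreme point of the convex hull of all the end-members $\{\theta_{k',j'}\}$ and lies in exactly one of the polytopes $\mathcal{S}_1,\dots,\mathcal{S}_K$. Let $\psi_0 \in \Psi$ be such that its end-member collection $\boldsymbol\Theta_0$ is totally exposed and, within each component, the $d$ end-members $\theta^0_{k,1},\dots,\theta^0_{k,d}$ are pairwise distinct. Then $$\liminf_{\substack{\psi \in \Psi,\ d(\psi,\psi_0) > 0 \\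 d(\psi,\psi_0) \to 0}} \frac{d_{\mathsf{TV}}(P_\psi, P_{\psi_0})}{d(\psi,\psi_0)} > 0,$$ where $d_{\mathsf{TV}}$ is the total variation distance. -/

import Mathlib

open MeasureTheory Filter Topology
open scoped ENNReal MeasureTheory

namespace PolytopeMixture

/-- The probability simplex `Δ^{d-1}` as a subset of Euclidean space `ℝ^d`. -/
def simplex (d : ℕ) : Set (EuclideanSpace ℝ (Fin d)) :=
  {β | (∀ j, 0 ≤ β j) ∧ ∑ j, β j = 1}

/-- A law on `ℝ^d` is exchangeable if it is invariant under all permutations of coordinates. -/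
def Exchangeable {d : ℕ} (Pβ : Measure (EuclideanSpace ℝ (Fin d))) : Prop :=
  ∀ τ : Equiv.Perm (Fin d),
    Pβ.map (fun β => (WithLp.toLp 2 (fun j => β (τ j)) : EuclideanSpace ℝ (Fin d))) = Pβ

/-- The parameter space `Ψ`: parameters `ψ = (Θ, π, Σ)` with `K` components, each with `d`
end-members in `ℝ^D`. The end-member `θ_{k,j}` is `Θ k j`, the mixture probability `π_k` is
`weight k`, and the noise variance `σ_k²` is `var k`. -/
structure Param (K d D : ℕ) where
  Θ : Fin K → Fin d → EuclideanSpace ℝ (Fin D)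
  weight : Fin K → ℝ
  var : Fin K → ℝ
  weight_pos : ∀ k, 0 < weight k
  weight_sum : ∑ k, weight k = 1
  var_pos : ∀ k, 0 < var k

/-- The density `φ(x | m, v I)` of the isotropic Gaussian on `ℝ^D` with mean `m` and
covariance matrix `v I`. -/
noncomputable def gaussianDensity {D : ℕ} (m : EuclideanSpace ℝ (Fin D)) (v : ℝ)
    (x : EuclideanSpace ℝ (Fin D)) : ℝ :=
  (2 * Real.pi * v) ^ (-(D : ℝ) / 2) * Real.exp (-‖x - m‖ ^ 2 / (2 * v))

/-- The point `Θ β = ∑_j β_j θ_j` of the polytope with end-members `θ_1, …, θ_d`. -/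
noncomputable def combine {d D : ℕ} (θ : Fin d → EuclideanSpace ℝ (Fin D))
    (β : EuclideanSpace ℝ (Fin d)) : EuclideanSpace ℝ (Fin D) :=
  ∑ j, β j • θ j

/-- The mixture density `p_ψ(x) = ∑_k π_k ∫ φ(x | Θ_k β, σ_k² I) dP_β(β)`. -/
noncomputable def density {K d D : ℕ} (Pβ : Measure (EuclideanSpace ℝ (Fin d)))
    (ψ : Param K d D) (x : EuclideanSpace ℝ (Fin D)) : ℝ :=
  ∑ k, ψ.weight k * ∫ β, gaussianDensity (combine (ψ.Θ k) β) (ψ.var k) x ∂Pβ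

/-- The measure `P_ψ` on `ℝ^D` with Lebesgue density `p_ψ`. -/
noncomputable def law {K d D : ℕ} (Pβ : Measure (EuclideanSpace ℝ (Fin d)))
    (ψ : Param K d D) : Measure (EuclideanSpace ℝ (Fin D)) :=
  volume.withDensity (fun x => ENNReal.ofReal (density Pβ ψ x))

/-- Total variation distance `sup_A |μ(A) - ν(A)|` over measurable `A`. -/
noncomputable def tvDist {X : Type*} [MeasurableSpace X] (μ ν : Measure X) : ℝ :=
  ⨆ A : {A : Set X // MeasurableSet A}, |μ.real A - ν.real A|

/-- The distance `d_M` between two arrays of end-members, up to their order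
(the infimum is a minimum over a finite group). -/
noncomputable def endmemberDist {d D : ℕ} (θ θ' : Fin d → EuclideanSpace ℝ (Fin D)) : ℝ :=
  ⨅ τ : Equiv.Perm (Fin d), ∑ j, ‖θ j - θ' (τ j)‖

/-- The pseudometric `d(ψ, ψ')` on parameters, invariant under relabelling of the components
and of the end-members within each component (the infimum is a minimum over a finite group). -/
noncomputable def paramDist {K d D : ℕ} (ψ ψ' : Param K d D) : ℝ :=
  ⨅ τ : Equiv.Perm (Fin K), ∑ k,
    (endmemberDist (ψ.Θ k) (ψ'.Θ (τ k)) + |ψ.weight k - ψ'.weight (τ k)|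
      + |ψ.var k - ψ'.var (τ k)|)

/-- The polytope `S_k = conv(θ_{k,1}, …, θ_{k,d})`. -/
def polytope {K d D : ℕ} (Θ : Fin K → Fin d → EuclideanSpace ℝ (Fin D)) (k : Fin K) :
    Set (EuclideanSpace ℝ (Fin D)) :=
  convexHull ℝ (Set.range (Θ k))

/-- The set `C(Θ)` of all end-members. -/
def endmembers {K d D : ℕ} (Θ : Fin K → Fin d → EuclideanSpace ℝ (Fin D)) :
    Set (EuclideanSpace ℝ (Fin D)) :=
  {θ | ∃ k j, θ = Θ k j}

/-- `θ` is exposed with respect to `Θ`: it is an extreme point of the convex hull of all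
end-members, and it belongs to exactly one of the polytopes. -/
def Exposed {K d D : ℕ} (Θ : Fin K → Fin d → EuclideanSpace ℝ (Fin D))
    (θ : EuclideanSpace ℝ (Fin D)) : Prop :=
  θ ∈ Set.extremePoints ℝ (convexHull ℝ (endmembers Θ)) ∧
    ∃ i : Fin K, θ ∈ polytope Θ i \ ⋃ k ∈ {k : Fin K | k ≠ i}, polytope Θ k

/-- `Θ` is totally exposed: every end-member of every component is exposed. -/
def TotallyExposed {K d D : ℕ} (Θ : Fin K → Fin d → EuclideanSpace ℝ (Fin D)) : Prop :=
  ∀ k j, Exposed Θ (Θ k j)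

end PolytopeMixture

/-!
The inverse bound is a first-order identifiability statement for the characteristic function
`ξ ↦ ∑ k, π k * exp (-σ k ^ 2 * ‖ξ‖ ^ 2 / 2) * ∫ β, exp (i ⟪ξ, Θ k β⟫)` of the mixture.

*Reduction.* The total variation distance dominates, up to the factor `2`, the difference of
characteristic functions at every `ξ` (`norm_mixtureCharFun_sub_le`). For fixed `ξ` this function
is differentiable in the parameters. If no nonzero direction of the parameter space is killed by
all these derivatives at `ψ₀`, then finitely many `ξ` already give an injective derivative, and
the differences grow at least linearly in the distance of the parameters
(`exists_eventually_mul_norm_sub_le`). By exchangeability, parameters that are close in `paramDist`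
may be relabelled so that they are close in norm (`exists_relabel`).

*Identifiability.* Let `(Δ, a, s)` be a direction killed by all derivatives. Along a line `ξ = t u`
the derivative extends to an entire function of `t`, so the relation holds at imaginary `t` too
(`eq_zero_of_fourier_eq_zero`), where it reads, with real `t`,
`∑ k, exp (σ k ^ 2 t ^ 2 ‖u‖ ^ 2 / 2) *
  E [(a k + π k t ⟪u, Δ k β⟫ + π k s k t ^ 2 ‖u‖ ^ 2 / 2) exp (t ⟪u, Θ k β⟫)] = 0`.
Take a component `k` of largest variance among those with a nonzero coefficient, an end-member
`θ k j`, and a direction `u` in which it is the unique maximizer among all end-members; total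
exposure provides an open set of these (`TotallyExposed.exists_inner_lt`). As `t → ∞` all other
terms are exponentially smaller, while the tilted law of `β` for the component `k` concentrates at
the vertex `j`, which lies in the support of the mixing law. Comparing powers of `t`
(`eq_zero_of_tendsto_tilted`) gives first `s k = 0`, then `⟪u, Δ k j⟫ = 0` for `u` in an open set,
so `Δ k j = 0`; once this is known for all `j`, also `a k = 0`, a contradiction
(`eq_zero_of_laplace_eq_zero`).
-/

namespace PolytopeMixture

/-! ### Exponentially tilted integrals -/

theorem tendsto_mul_sq_mul_exp_neg (C : ℝ) {r : ℝ} (hr : 0 < r) :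
    Tendsto (fun t : ℝ => C * t ^ 2 * Real.exp (-(r * t))) atTop (𝓝 0) := by
  have h := (Real.tendsto_pow_mul_exp_neg_atTop_nhds_zero 2).comp
    (tendsto_id.const_mul_atTop hr)
  have h2 := h.const_mul (C / r ^ 2)
  simp only [mul_zero] at h2
  refine h2.congr fun t => ?_
  simp only [Function.comp, id]
  field_simp

/-- Under the tilt `exp (t * X)` with `X ≤ 0`, the mass concentrates where `X` is near its supremum
`0`, and the tilted mass of that region decays more slowly than any exponential. So an integrand
bounded below by `κ > 0` there cannot have an exponentially small tilted integral, whatever its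
(polynomially bounded) values elsewhere. -/
theorem not_tendsto_exp_mul_integral_tilted {Ω : Type*} [MeasurableSpace Ω] {P : Measure Ω}
    [IsProbabilityMeasure P] {X : Ω → ℝ} (hX : Measurable X) (hX0 : ∀ᵐ ω ∂P, X ω ≤ 0)
    (hXpos : ∀ ε > 0, 0 < P {ω | -ε < X ω}) {q : ℝ → Ω → ℝ} (hq : ∀ t, Measurable (q t))
    {C : ℝ} (hC : ∀ t ≥ 1, ∀ᵐ ω ∂P, |q t ω| ≤ C * t ^ 2) {η κ δ : ℝ} (hη : 0 < η)
    (hκ : 0 < κ) (hδ : 0 < δ)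
    (hpos : ∀ᶠ t in atTop, ∀ᵐ ω ∂P, -η < X ω → κ ≤ q t ω) :
    ¬ Tendsto (fun t => Real.exp (δ * t) * ∫ ω, q t ω * Real.exp (t * X ω) ∂P) atTop (𝓝 0) := by
  intro hlim
  obtain ⟨ε, hε, hεδ, hεη⟩ : ∃ ε > 0, ε < δ ∧ ε < η :=
    ⟨min δ η / 2, by positivity, by have := min_le_left δ η; linarith [lt_min hδ hη],
      by have := min_le_right δ η; linarith [lt_min hδ hη]⟩
  -- On `S` the integrand is at least `κ * exp (-ε t)`; off `{X > -η}` it is at least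
  -- `-C t² exp (-η t)`, which is negligible because `ε < η`.
  set S : Set Ω := {ω | -ε < X ω} with hS
  have hSm : MeasurableSet S := measurableSet_lt measurable_const hX
  have hm : 0 < P.real S := ENNReal.toReal_pos (hXpos ε hε).ne' (measure_ne_top _ _)
  have hsmall : ∀ᶠ t : ℝ in atTop, C * t ^ 2 * Real.exp (-((η - ε) * t)) < κ * P.real S / 2 :=
    (tendsto_mul_sq_mul_exp_neg C (sub_pos.2 hεη)).eventually_lt_const (by positivity)
  have hlt : ∀ᶠ t : ℝ in atTop,
      Real.exp (δ * t) * ∫ ω, q t ω * Real.exp (t * X ω) ∂P < κ * P.real S / 2 :=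
    hlim.eventually_lt_const (by positivity)
  obtain ⟨t, hpt, hst, hltt, ht1⟩ :=
    (hpos.and (hsmall.and (hlt.and (eventually_ge_atTop (1 : ℝ))))).exists
  have ht0 : 0 < t := by linarith
  have hint : Integrable (fun ω => q t ω * Real.exp (t * X ω)) P := by
    refine Integrable.of_bound (C := C * t ^ 2) (by fun_prop) ?_
    filter_upwards [hX0, hC t ht1] with ω h0 hc
    rw [norm_mul, Real.norm_eq_abs, Real.norm_eq_abs, Real.abs_exp]
    calc |q t ω| * Real.exp (t * X ω) ≤ |q t ω| * 1 := by
          gcongr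
          exact Real.exp_le_one_iff.2 (mul_nonpos_of_nonneg_of_nonpos ht0.le h0)
      _ ≤ _ := by simpa using hc
  have hlow : κ * Real.exp (-(ε * t)) * P.real S - C * t ^ 2 * Real.exp (-(η * t))
      ≤ ∫ ω, q t ω * Real.exp (t * X ω) ∂P := by
    have : ∫ ω, (S.indicator (fun _ => κ * Real.exp (-(ε * t))) ω
        - C * t ^ 2 * Real.exp (-(η * t))) ∂P
        ≤ ∫ ω, q t ω * Real.exp (t * X ω) ∂P := by
      refine integral_mono_ae (((integrable_const _).indicator hSm).sub (integrable_const _))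
        hint ?_
      filter_upwards [hX0, hC t ht1, hpt] with ω h0 hc hp
      have hCt : 0 ≤ C * t ^ 2 := (abs_nonneg _).trans hc
      have hCe : 0 ≤ C * t ^ 2 * Real.exp (-(η * t)) := by positivity
      by_cases hωη : -η < X ω
      · have h1 := hp hωη
        by_cases hωS : ω ∈ S
        · rw [Set.indicator_of_mem hωS]
          have h2 : Real.exp (-(ε * t)) ≤ Real.exp (t * X ω) := by
            apply Real.exp_le_exp.2
            have : -ε < X ω := hωS
            nlinarith
          have h3 : κ * Real.exp (-(ε * t)) ≤ q t ω * Real.exp (t * X ω) := by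
            gcongr
            exact hκ.le.trans h1
          linarith
        · rw [Set.indicator_of_notMem hωS]
          have : 0 ≤ q t ω * Real.exp (t * X ω) :=
            mul_nonneg (hκ.le.trans h1) (Real.exp_pos _).le
          linarith
      · have hωS : ω ∉ S := fun h => hωη (by have : -ε < X ω := h; linarith)
        rw [Set.indicator_of_notMem hωS]
        have h2 : Real.exp (t * X ω) ≤ Real.exp (-(η * t)) := by
          apply Real.exp_le_exp.2
          push Not at hωη
          nlinarith
        have h3 : |q t ω * Real.exp (t * X ω)| ≤ C * t ^ 2 * Real.exp (-(η * t)) := by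
          rw [abs_mul, Real.abs_exp]
          gcongr
        have := neg_abs_le (q t ω * Real.exp (t * X ω))
        linarith
    rwa [integral_sub ((integrable_const _).indicator hSm) (integrable_const _),
      integral_indicator_const _ hSm, integral_const, probReal_univ, one_smul, smul_eq_mul,
      mul_comm (P.real S)] at this
  have e1 : Real.exp (δ * t) * (κ * Real.exp (-(ε * t)) * P.real S
      - C * t ^ 2 * Real.exp (-(η * t))) = Real.exp ((δ - ε) * t) *
      (κ * P.real S - C * t ^ 2 * Real.exp (-((η - ε) * t))) := by
    have h1 : Real.exp (δ * t) = Real.exp ((δ - ε) * t) * Real.exp (ε * t) := by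
      rw [← Real.exp_add]; ring_nf
    have h2 : Real.exp (-((η - ε) * t)) = Real.exp (ε * t) * Real.exp (-(η * t)) := by
      rw [← Real.exp_add]; ring_nf
    have h3 : Real.exp (ε * t) * Real.exp (-(ε * t)) = 1 := by
      rw [← Real.exp_add]; simp
    rw [h1, h2]
    linear_combination (Real.exp ((δ - ε) * t) * κ * P.real S) * h3
  have e2 : (1 : ℝ) ≤ Real.exp ((δ - ε) * t) :=
    Real.one_le_exp (mul_nonneg (by linarith) ht0.le)
  have e3 := mul_le_mul_of_nonneg_left hlow (Real.exp_pos (δ * t)).le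
  rw [e1] at e3
  have e4 : 0 < κ * P.real S := by positivity
  nlinarith

variable {d D K : ℕ}

theorem apply_le_one_of_mem_simplex {β : EuclideanSpace ℝ (Fin d)} (hβ : β ∈ simplex d)
    (i : Fin d) : β i ≤ 1 :=
  hβ.2 ▸ Finset.single_le_sum (fun i _ => hβ.1 i) (Finset.mem_univ i)

theorem abs_sum_mul_le_of_mem_simplex {β : EuclideanSpace ℝ (Fin d)} (hβ : β ∈ simplex d)
    (y : Fin d → ℝ) : |∑ i, β i * y i| ≤ ∑ i, |y i| := by
  refine (Finset.abs_sum_le_sum_abs _ _).trans (Finset.sum_le_sum fun i _ => ?_)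
  rw [abs_mul, abs_of_nonneg (hβ.1 i)]
  exact mul_le_of_le_one_left (abs_nonneg _) (apply_le_one_of_mem_simplex hβ i)

theorem sum_mul_le_of_mem_simplex {β : EuclideanSpace ℝ (Fin d)} (hβ : β ∈ simplex d)
    {y : Fin d → ℝ} {A : ℝ} (hy : ∀ i, y i ≤ A) : ∑ i, β i * y i ≤ A :=
  calc ∑ i, β i * y i ≤ ∑ i, β i * A :=
        Finset.sum_le_sum fun i _ => mul_le_mul_of_nonneg_left (hy i) (hβ.1 i)
    _ = A := by rw [← Finset.sum_mul, hβ.2, one_mul]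

/-- On the simplex, an affine function that vanishes at the vertex `j` is controlled by
`1 - β j`. -/
theorem sum_mul_le_mul_one_sub {β : EuclideanSpace ℝ (Fin d)} (hβ : β ∈ simplex d)
    {x : Fin d → ℝ} {j : Fin d} (hj : x j = 0) {b : ℝ} (hx : ∀ i, i ≠ j → x i ≤ b) :
    ∑ i, β i * x i ≤ b * (1 - β j) := by
  have h : 1 - β j = ∑ i ∈ Finset.univ.erase j, β i := by
    rw [← hβ.2, ← Finset.add_sum_erase _ _ (Finset.mem_univ j)]; ring
  rw [← Finset.add_sum_erase _ _ (Finset.mem_univ j), hj, mul_zero, zero_add, h, Finset.mul_sum]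
  refine Finset.sum_le_sum fun i hi => ?_
  rw [mul_comm b]
  exact mul_le_mul_of_nonneg_left (hx i (Finset.ne_of_mem_erase hi)) (hβ.1 i)

theorem abs_quadratic_le_of_mem_simplex {β : EuclideanSpace ℝ (Fin d)} (hβ : β ∈ simplex d)
    (a c : ℝ) (y : Fin d → ℝ) {t : ℝ} (ht : 1 ≤ t) :
    |a + t * ∑ i, β i * y i + t ^ 2 * c| ≤ (|a| + ∑ i, |y i| + |c|) * t ^ 2 := by
  have h2 : 1 ≤ t ^ 2 := one_le_pow₀ ht
  have h3 : t ≤ t ^ 2 := by nlinarith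
  have h0 : 0 ≤ ∑ i, |y i| := Finset.sum_nonneg fun i _ => abs_nonneg _
  calc |a + t * ∑ i, β i * y i + t ^ 2 * c|
      ≤ |a| + |t * ∑ i, β i * y i| + |t ^ 2 * c| := abs_add_three _ _ _
    _ = |a| + t * |∑ i, β i * y i| + t ^ 2 * |c| := by
        rw [abs_mul, abs_mul, abs_of_pos (by linarith : 0 < t), abs_of_nonneg (sq_nonneg t)]
    _ ≤ |a| * t ^ 2 + t ^ 2 * ∑ i, |y i| + t ^ 2 * |c| := by
        gcongr
        · exact le_mul_of_one_le_right (abs_nonneg _) h2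
        · exact abs_sum_mul_le_of_mem_simplex hβ y
    _ = _ := by ring

/-- The linear function `∑ i, β i * x i` has its maximum over the simplex, `0`, at the vertex `j`
only. Near that vertex `a + t * ∑ i, β i * y i + t ^ 2 * c` is bounded away from zero for large `t`
as soon as its leading coefficient there is positive; the coefficient `a` counts only when `y`
vanishes identically, because `t * ∑ i, β i * y i` need not be small near a vertex with
`y j = 0`. -/
theorem not_tendsto_of_pos {P : Measure (EuclideanSpace ℝ (Fin d))} [IsProbabilityMeasure P]
    (hs : ∀ᵐ β ∂P, β ∈ simplex d) {j : Fin d} (hv : EuclideanSpace.single j 1 ∈ P.support)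
    {x y : Fin d → ℝ} {γ : ℝ} (hγ : 0 < γ) (hxj : x j = 0) (hx : ∀ i, i ≠ j → x i ≤ -γ)
    {a c δ : ℝ} (hδ : 0 < δ)
    (h : 0 < c ∨ (c = 0 ∧ 0 < y j) ∨ (c = 0 ∧ y = 0 ∧ 0 < a)) :
    ¬ Tendsto (fun t => Real.exp (δ * t) * ∫ β, (a + t * ∑ i, β i * y i + t ^ 2 * c)
      * Real.exp (t * ∑ i, β i * x i) ∂P) atTop (𝓝 0) := by
  set B := ∑ i, |y i| with hB
  have hB0 : 0 ≤ B := Finset.sum_nonneg fun i _ => abs_nonneg _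
  obtain ⟨η, κ, hη, hκ, hpos⟩ : ∃ η κ : ℝ, 0 < η ∧ 0 < κ ∧ ∀ᶠ t in atTop, ∀ᵐ β ∂P,
      -η < ∑ i, β i * x i → κ ≤ a + t * ∑ i, β i * y i + t ^ 2 * c := by
    rcases h with hc | ⟨rfl, hy⟩ | ⟨rfl, rfl, ha⟩
    · refine ⟨1, 1, one_pos, one_pos, ?_⟩
      filter_upwards [eventually_ge_atTop ((1 + |a| + B) / c), eventually_ge_atTop 1] with t ht ht1
      filter_upwards [hs] with β hβ _
      have h1 := (abs_le.1 (abs_sum_mul_le_of_mem_simplex hβ y)).1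
      rw [div_le_iff₀ hc] at ht
      have h2 := neg_abs_le a
      have h3 := abs_nonneg a
      nlinarith
    · set B' := ∑ i, |y j - y i| with hB'
      have hB'0 : 0 ≤ B' := Finset.sum_nonneg fun i _ => abs_nonneg _
      -- `-η < ∑ i, β i * x i` forces `1 - β j < η / γ`, hence `y j / 2 ≤ ∑ i, β i * y i`.
      refine ⟨γ * (y j / (2 * (B' + 1))), 1, by positivity, one_pos, ?_⟩
      filter_upwards [eventually_ge_atTop ((1 + |a|) / (y j / 2)), eventually_ge_atTop 1]
        with t ht ht1
      filter_upwards [hs] with β hβ hX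
      have h1 : ∑ i, β i * x i ≤ -γ * (1 - β j) := sum_mul_le_mul_one_sub hβ hxj hx
      have h2 : ∑ i, β i * (y j - y i) ≤ B' * (1 - β j) :=
        sum_mul_le_mul_one_sub hβ (sub_self _) fun i _ => (le_abs_self _).trans
          (Finset.single_le_sum (f := fun i => |y j - y i|) (fun i _ => abs_nonneg _)
            (Finset.mem_univ i))
      have h3 : ∑ i, β i * (y j - y i) = y j - ∑ i, β i * y i := by
        simp only [mul_sub, Finset.sum_sub_distrib, ← Finset.sum_mul, hβ.2, one_mul]
      have h4 : 1 - β j < y j / (2 * (B' + 1)) := by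
        by_contra hcon
        push Not at hcon
        have := mul_le_mul_of_nonneg_left hcon hγ.le
        linarith
      have h5 : B' * (1 - β j) ≤ y j / 2 := by
        calc B' * (1 - β j) ≤ B' * (y j / (2 * (B' + 1))) :=
              mul_le_mul_of_nonneg_left h4.le hB'0
          _ ≤ (B' + 1) * (y j / (2 * (B' + 1))) := by gcongr; linarith
          _ = y j / 2 := by field_simp
      have h6 : y j / 2 ≤ ∑ i, β i * y i := by linarith
      rw [div_le_iff₀ (by positivity)] at ht
      have h7 := neg_abs_le a
      nlinarith
    · refine ⟨1, a, one_pos, ha, Eventually.of_forall fun t => Eventually.of_forall fun β _ => ?_⟩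
      simp
  refine not_tendsto_exp_mul_integral_tilted (C := |a| + B + |c|) (by fun_prop) ?_ ?_
    (fun t => by fun_prop) (fun t ht => ?_) hη hκ hδ hpos
  · filter_upwards [hs] with β hβ
    refine sum_mul_le_of_mem_simplex hβ fun i => ?_
    rcases eq_or_ne i j with rfl | hi
    · exact hxj.le
    · linarith [hx i hi]
  · intro ε hε
    refine (Measure.mem_support_iff_forall _).1 hv _ (IsOpen.mem_nhds ?_ ?_)
    · exact isOpen_lt continuous_const (by fun_prop)
    · simp [hxj, hε]
  · filter_upwards [hs] with β hβ using abs_quadratic_le_of_mem_simplex hβ a c y ht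

theorem eq_zero_of_tendsto_tilted {P : Measure (EuclideanSpace ℝ (Fin d))}
    [IsProbabilityMeasure P]
    (hs : ∀ᵐ β ∂P, β ∈ simplex d) {j : Fin d} (hv : EuclideanSpace.single j 1 ∈ P.support)
    {x y : Fin d → ℝ} {γ : ℝ} (hγ : 0 < γ) (hxj : x j = 0) (hx : ∀ i, i ≠ j → x i ≤ -γ)
    {a c δ : ℝ} (hδ : 0 < δ)
    (h : Tendsto (fun t => Real.exp (δ * t) * ∫ β, (a + t * ∑ i, β i * y i + t ^ 2 * c)
      * Real.exp (t * ∑ i, β i * x i) ∂P) atTop (𝓝 0)) :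
    c = 0 ∧ y j = 0 ∧ (y = 0 → a = 0) := by
  have h' : Tendsto (fun t => Real.exp (δ * t) * ∫ β, (-a + t * ∑ i, β i * (-y) i + t ^ 2 * -c)
      * Real.exp (t * ∑ i, β i * x i) ∂P) atTop (𝓝 0) := by
    have := h.neg
    rw [neg_zero] at this
    refine this.congr fun t => ?_
    rw [← mul_neg, ← integral_neg]
    congr 2 with β
    simp only [Pi.neg_apply, mul_neg, Finset.sum_neg_distrib]
    ring
  have p1 := fun H => not_tendsto_of_pos hs hv hγ hxj hx hδ H h
  have p2 := fun H => not_tendsto_of_pos hs hv hγ hxj hx hδ H h'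
  have hc : c = 0 := by
    rcases lt_trichotomy c 0 with hc | hc | hc
    · exact (p2 (Or.inl (by linarith))).elim
    · exact hc
    · exact (p1 (Or.inl hc)).elim
  refine ⟨hc, ?_, fun hy => ?_⟩
  · rcases lt_trichotomy (y j) 0 with hy | hy | hy
    · exact (p2 (Or.inr (Or.inl ⟨by simp [hc], by simpa using hy⟩))).elim
    · exact hy
    · exact (p1 (Or.inr (Or.inl ⟨hc, hy⟩))).elim
  · rcases lt_trichotomy a 0 with ha | ha | ha
    · exact (p2 (Or.inr (Or.inr ⟨by simp [hc], by simp [hy], by linarith⟩))).elim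
    · exact ha
    · exact (p1 (Or.inr (Or.inr ⟨hc, hy, ha⟩))).elim

/-! ### Directions exposing an end-member -/

theorem inner_combine (u : EuclideanSpace ℝ (Fin D)) (θ : Fin d → EuclideanSpace ℝ (Fin D))
    (β : EuclideanSpace ℝ (Fin d)) :
    inner ℝ u (combine θ β) = ∑ i, β i * inner ℝ u (θ i) := by
  simp [combine, inner_sum, inner_smul_right]

/-- Total exposure together with distinctness inside the components makes all `K * d` end-members
distinct. -/
theorem TotallyExposed.ne {Θ : Fin K → Fin d → EuclideanSpace ℝ (Fin D)} (hexp : TotallyExposed Θ)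
    (hinj : ∀ k, Function.Injective (Θ k)) {k k' : Fin K} {j j' : Fin d}
    (h : (k', j') ≠ (k, j)) : Θ k' j' ≠ Θ k j := by
  intro heq
  have mem : ∀ k j, Θ k j ∈ polytope Θ k := fun k j => subset_convexHull ℝ _ ⟨j, rfl⟩
  rcases eq_or_ne k' k with rfl | hk
  · exact h (by rw [hinj k' heq])
  · obtain ⟨-, i, -, hi⟩ := hexp k j
    have key : ∀ l, Θ k j ∈ polytope Θ l → l = i := by
      intro l hl
      by_contra hne
      exact hi (Set.mem_biUnion (show l ∈ {k : Fin K | k ≠ i} from hne) hl)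
    exact hk ((key k' (heq ▸ mem k' j')).trans (key k (mem k j)).symm)

/-- Every end-member is the unique maximizer, among all end-members, of some linear functional. -/
theorem TotallyExposed.exists_inner_lt {Θ : Fin K → Fin d → EuclideanSpace ℝ (Fin D)}
    (hexp : TotallyExposed Θ) (hinj : ∀ k, Function.Injective (Θ k)) (k : Fin K) (j : Fin d) :
    ∃ u : EuclideanSpace ℝ (Fin D), ∀ k' j', (k', j') ≠ (k, j) →
      inner ℝ u (Θ k' j') < inner ℝ u (Θ k j) := by
  set T : Set (EuclideanSpace ℝ (Fin D)) :=
    (fun p : Fin K × Fin d => Θ p.1 p.2) '' {p | p ≠ (k, j)} with hT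
  have hTsub : T ⊆ convexHull ℝ (endmembers Θ) \ {Θ k j} := by
    rintro _ ⟨⟨k', j'⟩, hp, rfl⟩
    exact ⟨subset_convexHull ℝ _ ⟨k', j', rfl⟩, hexp.ne hinj hp⟩
  have hnot : Θ k j ∉ convexHull ℝ T := fun hmem =>
    ((convex_convexHull ℝ _).mem_extremePoints_iff_mem_sdiff_convexHull_sdiff.1
      (hexp k j).1).2 (convexHull_mono hTsub hmem)
  have hclosed : IsClosed (convexHull ℝ T) :=
    (Set.toFinite T).isClosed_convexHull ℝ
  obtain ⟨f, r, hfr, hf⟩ := geometric_hahn_banach_point_closed (convex_convexHull ℝ T) hclosed hnot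
  refine ⟨(InnerProductSpace.toDual ℝ _).symm (-f), fun k' j' h => ?_⟩
  have := hf _ (subset_convexHull ℝ _ ⟨(k', j'), h, rfl⟩)
  simp only [InnerProductSpace.toDual_symm_apply, neg_apply]
  linarith

/-- The functionals singling out one end-member form an open set, so that they determine a vector
annihilated by all of them. The proposition `p` is any further conclusion that one nonzero
functional of this kind yields. -/
theorem eq_zero_of_inner_eq_zero_of_exposing (hD : 0 < D)
    {Θ : Fin K → Fin d → EuclideanSpace ℝ (Fin D)}
    (hexp : TotallyExposed Θ) (hinj : ∀ k, Function.Injective (Θ k)) (k : Fin K) (j : Fin d)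
    {p : Prop} {w : EuclideanSpace ℝ (Fin D)}
    (h : ∀ u : EuclideanSpace ℝ (Fin D), u ≠ 0 → (∀ k' j', (k', j') ≠ (k, j) →
      inner ℝ u (Θ k' j') < inner ℝ u (Θ k j)) → p ∧ inner ℝ u w = 0) : p ∧ w = 0 := by
  have : Nonempty (Fin D) := ⟨⟨0, hD⟩⟩
  set U : Set (EuclideanSpace ℝ (Fin D)) := {u | ∀ k' j', (k', j') ≠ (k, j) →
      inner ℝ u (Θ k' j') < inner ℝ u (Θ k j)} with hU
  have hUo : IsOpen U := by
    simp only [hU, Set.ofPred_forall]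
    refine isOpen_iInter_of_finite fun k' => isOpen_iInter_of_finite fun j' =>
      isOpen_iInter_of_finite fun _ => isOpen_lt (by fun_prop) (by fun_prop)
  obtain ⟨u₀, hu₀⟩ := hexp.exists_inner_lt hinj k j
  obtain ⟨u, hu, hu0⟩ : ∃ u ∈ U, u ≠ 0 := by
    have := (dense_compl_singleton (0 : EuclideanSpace ℝ (Fin D))).inter_open_nonempty U hUo
      ⟨u₀, hu₀⟩
    obtain ⟨u, h1, h2⟩ := this
    exact ⟨u, h1, h2⟩
  refine ⟨(h u hu0 hu).1, ?_⟩
  have hopen : ∀ᶠ s : ℝ in 𝓝 0, u + s • w ∈ U ∩ {0}ᶜ := by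
    have hc : ContinuousAt (fun s : ℝ => u + s • w) 0 := by fun_prop
    refine hc.eventually_mem ((hUo.inter isOpen_compl_singleton).mem_nhds ?_)
    simpa using ⟨hu, hu0⟩
  obtain ⟨s, hs, hs0⟩ := ((hopen.filter_mono nhdsWithin_le_nhds).and
    (self_mem_nhdsWithin (a := (0 : ℝ)) (s := Set.Ioi 0))).exists
  have h1 := (h _ hs.2 hs.1).2
  rw [inner_add_left, (h u hu0 hu).2, zero_add, inner_smul_left] at h1
  simpa [hs0.ne'] using h1

/-! ### First-order identifiability -/

theorem abs_integral_mul_exp_le {P : Measure (EuclideanSpace ℝ (Fin d))} [IsProbabilityMeasure P]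
    (hs : ∀ᵐ β ∂P, β ∈ simplex d) (a c : ℝ) (y x : Fin d → ℝ) {A t : ℝ} (hx : ∀ i, x i ≤ A)
    (ht : 1 ≤ t) :
    |∫ β, (a + t * ∑ i, β i * y i + t ^ 2 * c) * Real.exp (t * ∑ i, β i * x i) ∂P|
      ≤ (|a| + ∑ i, |y i| + |c|) * t ^ 2 * Real.exp (t * A) := by
  rw [← Real.norm_eq_abs]
  refine (norm_integral_le_of_norm_le_const (μ := P) (C := (|a| + ∑ i, |y i| + |c|) * t ^ 2 *
    Real.exp (t * A)) ?_).trans (by rw [probReal_univ, mul_one])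
  filter_upwards [hs] with β hβ
  rw [norm_mul, Real.norm_eq_abs, Real.norm_eq_abs, Real.abs_exp]
  gcongr
  · exact abs_quadratic_le_of_mem_simplex hβ a c y ht
  · exact sum_mul_le_of_mem_simplex hβ hx

/-- First-order identifiability on the side of the Laplace transform. The term of index `k` is the
derivative of `p k * exp (v k * ‖t • u‖ ^ 2 / 2) * ∫ β, exp ⟪t • u, combine (Θ k) β⟫` in the
direction `(Δ, a, s)`. Along a direction `u` exposing an end-member of `k`, a component `k` of
largest variance among those that contribute dominates the sum. -/
theorem eq_zero_of_laplace_eq_zero (hD : 0 < D)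
    {P : Measure (EuclideanSpace ℝ (Fin d))} [IsProbabilityMeasure P]
    (hs : ∀ᵐ β ∂P, β ∈ simplex d) (hv : ∀ j, EuclideanSpace.single j 1 ∈ P.support)
    [Nonempty (Fin d)]
    {Θ : Fin K → Fin d → EuclideanSpace ℝ (Fin D)} {p v : Fin K → ℝ} (hp : ∀ k, 0 < p k)
    (hexp : TotallyExposed Θ) (hinj : ∀ k, Function.Injective (Θ k))
    {Δ : Fin K → Fin d → EuclideanSpace ℝ (Fin D)} {a s : Fin K → ℝ}
    (h : ∀ (u : EuclideanSpace ℝ (Fin D)) (t : ℝ),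
      ∑ k, Real.exp (v k * ‖u‖ ^ 2 / 2 * t ^ 2) * ∫ β, (a k
        + t * ∑ i, β i * (p k * inner ℝ u (Δ k i)) + t ^ 2 * (p k * s k * ‖u‖ ^ 2 / 2))
        * Real.exp (t * ∑ i, β i * inner ℝ u (Θ k i)) ∂P = 0) :
    Δ = 0 ∧ a = 0 ∧ s = 0 := by
  by_contra hne
  set Act : Set (Fin K) := {k | ¬ (Δ k = 0 ∧ a k = 0 ∧ s k = 0)} with hAct
  have hActne : Act.Nonempty := by
    by_contra hem
    rw [Set.not_nonempty_iff_eq_empty] at hem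
    have hall : ∀ k, Δ k = 0 ∧ a k = 0 ∧ s k = 0 := fun k => by
      by_contra hk
      have : k ∈ Act := hk
      simp [hem] at this
    exact hne ⟨funext fun k => (hall k).1, funext fun k => (hall k).2.1,
      funext fun k => (hall k).2.2⟩
  -- Among the components that contribute, one of largest variance.
  obtain ⟨k, hk, hmax⟩ := Set.exists_max_image Act v (Set.toFinite _) hActne
  apply hk
  have key : ∀ (j : Fin d) (u : EuclideanSpace ℝ (Fin D)), u ≠ 0 → (∀ k' j', (k', j') ≠ (k, j) →
      inner ℝ u (Θ k' j') < inner ℝ u (Θ k j)) →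
      p k * s k * ‖u‖ ^ 2 / 2 = 0 ∧ p k * inner ℝ u (Δ k j) = 0 ∧
        ((fun i => p k * inner ℝ u (Δ k i)) = 0 → a k = 0) := by
    intro j u hu hlt
    set A := inner ℝ u (Θ k j) with hA
    obtain ⟨γ, hγ, hgap⟩ : ∃ γ > 0, ∀ k' j', (k', j') ≠ (k, j) →
        inner ℝ u (Θ k' j') ≤ A - γ := by
      have hev : ∀ᶠ γ : ℝ in 𝓝[>] 0, ∀ q : Fin K × Fin d, q ≠ (k, j) →
          inner ℝ u (Θ q.1 q.2) ≤ A - γ := by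
        rw [eventually_all]
        intro q
        by_cases hq : q = (k, j)
        · exact Eventually.of_forall fun _ h => (h hq).elim
        · have := hlt q.1 q.2 hq
          filter_upwards [Ioo_mem_nhdsGT (sub_pos.2 this)] with γ hγ _
          linarith [hγ.2]
      obtain ⟨γ, h1, h2⟩ := (hev.and self_mem_nhdsWithin).exists
      exact ⟨γ, h2, fun k' j' hq => h1 (k', j') hq⟩
    set I : Fin K → ℝ → ℝ := fun k' t => ∫ β, (a k'
        + t * ∑ i, β i * (p k' * inner ℝ u (Δ k' i)) + t ^ 2 * (p k' * s k' * ‖u‖ ^ 2 / 2))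
        * Real.exp (t * ∑ i, β i * inner ℝ u (Θ k' i)) ∂P with hI
    -- The terms of the sum, normalized so that all but the one of index `k` tend to zero.
    set R : Fin K → ℝ → ℝ := fun k' t => Real.exp ((v k' - v k) * ‖u‖ ^ 2 / 2 * t ^ 2) *
      (Real.exp (-(t * (A - γ / 2))) * I k' t) with hR
    have hother : ∀ k', k' ≠ k → Tendsto (R k') atTop (𝓝 0) := by
      intro k' hk'
      by_cases hact : k' ∈ Act
      · have hvle : v k' ≤ v k := hmax k' hact
        set C := |a k'| + ∑ i, |p k' * inner ℝ u (Δ k' i)| + |p k' * s k' * ‖u‖ ^ 2 / 2|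
        refine squeeze_zero_norm' ?_ (tendsto_mul_sq_mul_exp_neg C (half_pos hγ))
        filter_upwards [eventually_ge_atTop 1] with t ht
        have hb : |I k' t| ≤ C * t ^ 2 * Real.exp (t * (A - γ)) :=
          abs_integral_mul_exp_le hs _ _ _ _ (fun i => hgap k' i (by simp [hk'])) ht
        have he : Real.exp ((v k' - v k) * ‖u‖ ^ 2 / 2 * t ^ 2) ≤ 1 := by
          apply Real.exp_le_one_iff.2
          have h1 : 0 ≤ (v k - v k') * ‖u‖ ^ 2 / 2 * t ^ 2 := by
            have := sub_nonneg.2 hvle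
            positivity
          linarith
        calc ‖R k' t‖ = Real.exp ((v k' - v k) * ‖u‖ ^ 2 / 2 * t ^ 2) *
              (Real.exp (-(t * (A - γ / 2))) * |I k' t|) := by
              simp only [hR, norm_mul, Real.norm_eq_abs, Real.abs_exp]
          _ ≤ 1 * (Real.exp (-(t * (A - γ / 2))) * (C * t ^ 2 * Real.exp (t * (A - γ)))) := by
              gcongr
          _ = C * t ^ 2 * (Real.exp (-(t * (A - γ / 2))) * Real.exp (t * (A - γ))) := by ring
          _ = C * t ^ 2 * Real.exp (-(γ / 2 * t)) := by
              rw [← Real.exp_add]; ring_nf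
      · have h0 : Δ k' = 0 ∧ a k' = 0 ∧ s k' = 0 := not_not.1 hact
        have : R k' = fun _ => 0 := by
          funext t
          simp [hR, hI, h0.1, h0.2.1, h0.2.2]
        rw [this]
        exact tendsto_const_nhds
    have hsum : ∀ t, ∑ k', R k' t = 0 := by
      intro t
      have h1 := congrArg (fun z => Real.exp (-(v k * ‖u‖ ^ 2 / 2 * t ^ 2)) *
        Real.exp (-(t * (A - γ / 2))) * z) (h u t)
      rw [mul_zero, Finset.mul_sum] at h1
      rw [← h1]
      refine Finset.sum_congr rfl fun k' _ => ?_
      have h2 : Real.exp ((v k' - v k) * ‖u‖ ^ 2 / 2 * t ^ 2)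
          = Real.exp (-(v k * ‖u‖ ^ 2 / 2 * t ^ 2)) * Real.exp (v k' * ‖u‖ ^ 2 / 2 * t ^ 2) := by
        rw [← Real.exp_add]; ring_nf
      simp only [hR, hI, h2]
      ring
    have hRk : Tendsto (R k) atTop (𝓝 0) := by
      have h1 : Tendsto (fun t => -∑ k' ∈ Finset.univ.erase k, R k' t) atTop (𝓝 0) := by
        have := (tendsto_finsetSum (Finset.univ.erase k)
          fun k' hk' => hother k' (Finset.ne_of_mem_erase hk')).neg
        simpa using this
      refine h1.congr fun t => ?_
      have := hsum t
      rw [← Finset.add_sum_erase _ _ (Finset.mem_univ k)] at this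
      linarith
    -- The normalized term of index `k` is the tilted integral of exponents shifted to maximum `0`.
    refine eq_zero_of_tendsto_tilted hs (hv j) hγ
      (x := fun i => inner ℝ u (Θ k i) - A) (y := fun i => p k * inner ℝ u (Δ k i))
      (sub_self _)
      (fun i hi => by linarith [hgap k i (by simp [hi])]) (half_pos hγ) ?_
    refine hRk.congr fun t => ?_
    simp only [hR, hI, sub_self, zero_mul, zero_div, Real.exp_zero, one_mul]
    rw [← integral_const_mul, ← integral_const_mul]
    refine integral_congr_ae ?_
    filter_upwards [hs] with β hβ
    have h1 : ∑ i, β i * (inner ℝ u (Θ k i) - A) = ∑ i, β i * inner ℝ u (Θ k i) - A := by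
      simp only [mul_sub, Finset.sum_sub_distrib, ← Finset.sum_mul, hβ.2, one_mul]
    have h2 : Real.exp (-(t * (A - γ / 2))) * Real.exp (t * ∑ i, β i * inner ℝ u (Θ k i))
        = Real.exp (γ / 2 * t) * Real.exp (t * ∑ i, β i * (inner ℝ u (Θ k i) - A)) := by
      rw [h1, ← Real.exp_add, ← Real.exp_add]; ring_nf
    linear_combination (a k + t * ∑ i, β i * (p k * inner ℝ u (Δ k i))
      + t ^ 2 * (p k * s k * ‖u‖ ^ 2 / 2)) * h2
  have hΔs : ∀ j, s k = 0 ∧ Δ k j = 0 := fun j =>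
    eq_zero_of_inner_eq_zero_of_exposing hD hexp hinj k j fun u hu hlt => by
      obtain ⟨h1, h2, -⟩ := key j u hu hlt
      have hpk := (hp k).ne'
      exact ⟨by simpa [hpk, hu] using h1, by simpa [hpk] using h2⟩
  have hΔ : Δ k = 0 := funext fun j => (hΔs j).2
  obtain ⟨j⟩ := ‹Nonempty (Fin d)›
  refine ⟨hΔ, ?_, (hΔs j).1⟩
  -- Only now that `Δ k = 0` is known does the tilted integral determine `a k`.
  exact (eq_zero_of_inner_eq_zero_of_exposing (w := 0) hD hexp hinj k j fun u hu hlt =>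
    ⟨(key j u hu hlt).2.2 (by funext i; simp [hΔ]), by simp⟩).1

/-! ### Characteristic functions and their derivatives in the parameters -/

theorem continuous_inner_combine (ξ : EuclideanSpace ℝ (Fin D))
    (θ : Fin d → EuclideanSpace ℝ (Fin D)) :
    Continuous fun β => inner ℝ ξ (combine θ β) := by
  simp only [inner_combine]
  fun_prop

/-- The characteristic function at `ξ` of the image of `P` under `β ↦ ∑ j, β j • θ j`. -/
noncomputable def polytopeCharFun (P : Measure (EuclideanSpace ℝ (Fin d)))
    (ξ : EuclideanSpace ℝ (Fin D)) (θ : Fin d → EuclideanSpace ℝ (Fin D)) : ℂ :=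
  ∫ β, Complex.exp (inner ℝ ξ (combine θ β) * Complex.I) ∂P

/-- Differentiation under the integral sign; the derivative is described by its values. -/
theorem exists_hasFDerivAt_polytopeCharFun {P : Measure (EuclideanSpace ℝ (Fin d))}
    [IsProbabilityMeasure P] (hs : ∀ᵐ β ∂P, β ∈ simplex d) (ξ : EuclideanSpace ℝ (Fin D))
    (θ : Fin d → EuclideanSpace ℝ (Fin D)) :
    ∃ L : (Fin d → EuclideanSpace ℝ (Fin D)) →L[ℝ] ℂ,
      HasFDerivAt (polytopeCharFun P ξ) L θ ∧ ∀ η, L η =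
        ∫ β, Complex.exp (inner ℝ ξ (combine θ β) * Complex.I)
          * (inner ℝ ξ (combine η β) * Complex.I) ∂P := by
  set C : Fin d → (Fin d → EuclideanSpace ℝ (Fin D)) →L[ℝ] ℂ := fun j =>
    (Complex.ofRealCLM.smulRight Complex.I : ℝ →L[ℝ] ℂ) ∘L (innerSL ℝ ξ) ∘L
      (ContinuousLinearMap.proj (R := ℝ) (φ := fun _ : Fin d => EuclideanSpace ℝ (Fin D)) j)
    with hC
  set B : EuclideanSpace ℝ (Fin d) → (Fin d → EuclideanSpace ℝ (Fin D)) →L[ℝ] ℂ :=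
    fun β => ∑ j, β j • C j with hB
  have hBapp : ∀ β η, B β η = inner ℝ ξ (combine η β) * Complex.I := by
    intro β η
    rw [inner_combine]
    simp [hB, hC, Finset.sum_mul, mul_assoc]
  have hBcont : Continuous B := by fun_prop
  have hBbound : ∀ᵐ β ∂P, ‖B β‖ ≤ ∑ j, ‖C j‖ := by
    filter_upwards [hs] with β hβ
    refine (norm_sum_le _ _).trans (Finset.sum_le_sum fun j _ => ?_)
    rw [norm_smul, Real.norm_of_nonneg (hβ.1 j)]
    exact mul_le_of_le_one_left (norm_nonneg _) (apply_le_one_of_mem_simplex hβ j)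
  have hexp1 : ∀ β η, ‖Complex.exp (B β η)‖ = 1 := fun β η => by
    rw [hBapp]; exact Complex.norm_exp_ofReal_mul_I _
  have hfun : polytopeCharFun P ξ = fun η => ∫ β, Complex.exp (B β η) ∂P := by
    funext η
    simp only [polytopeCharFun, hBapp]
  have hmeas : ∀ η, Continuous fun β => Complex.exp (B β η) := fun η => by fun_prop
  have hF'c : Continuous fun β => Complex.exp (B β θ) • B β := (hmeas θ).smul hBcont
  have hF'b : ∀ η, ∀ᵐ β ∂P, ‖Complex.exp (B β η) • B β‖ ≤ ∑ j, ‖C j‖ := by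
    intro η
    filter_upwards [hBbound] with β hβ
    rw [norm_smul, hexp1, one_mul]
    exact hβ
  have hmain := hasFDerivAt_integral_of_dominated_of_fderiv_le (μ := P)
    (F := fun η β => Complex.exp (B β η)) (F' := fun η β => Complex.exp (B β η) • B β)
    (x₀ := θ) (s := Set.univ) (bound := fun _ => ∑ j, ‖C j‖) univ_mem
    (Eventually.of_forall fun η => (hmeas η).aestronglyMeasurable)
    (Integrable.of_bound (hmeas θ).aestronglyMeasurable 1
      (Eventually.of_forall fun β => (hexp1 β θ).le))
    hF'c.aestronglyMeasurable
    (by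
      filter_upwards [hBbound] with β hβ η _
      rw [norm_smul, hexp1, one_mul]
      exact hβ)
    (integrable_const _)
    (Eventually.of_forall fun β η _ =>
      (Complex.hasDerivAt_exp _).comp_hasFDerivAt_of_eq η (B β).hasFDerivAt rfl)
  refine ⟨_, hfun ▸ hmain, fun η => ?_⟩
  rw [ContinuousLinearMap.integral_apply (Integrable.of_bound hF'c.aestronglyMeasurable _ (hF'b θ))]
  simp only [smul_apply, hBapp, smul_eq_mul]

/-- The linear space of parameters without positivity and normalization constraints:
end-members, weights and variances. -/
abbrev ParamSpace (K d D : ℕ) : Type :=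
  (Fin K → Fin d → EuclideanSpace ℝ (Fin D)) × (Fin K → ℝ) × (Fin K → ℝ)

/-- The characteristic function of the mixture at `ξ`, as a function of the parameters. -/
noncomputable def mixtureCharFun (P : Measure (EuclideanSpace ℝ (Fin d)))
    (ξ : EuclideanSpace ℝ (Fin D)) (w : ParamSpace K d D) : ℂ :=
  ∑ k, (w.2.1 k : ℂ) * (Complex.exp (-(w.2.2 k * ‖ξ‖ ^ 2 / 2 : ℝ)) * polytopeCharFun P ξ (w.1 k))

theorem exists_hasFDerivAt_mixtureCharFun {P : Measure (EuclideanSpace ℝ (Fin d))}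
    [IsProbabilityMeasure P] (hs : ∀ᵐ β ∂P, β ∈ simplex d) (ξ : EuclideanSpace ℝ (Fin D))
    (w : ParamSpace K d D) :
    ∃ L : ParamSpace K d D →L[ℝ] ℂ, HasFDerivAt (mixtureCharFun P ξ) L w ∧
      ∀ h : ParamSpace K d D, L h = ∑ k, Complex.exp (-(w.2.2 k * ‖ξ‖ ^ 2 / 2 : ℝ)) *
        ((h.2.1 k : ℂ) * polytopeCharFun P ξ (w.1 k)
          + w.2.1 k * ∫ β, Complex.exp (inner ℝ ξ (combine (w.1 k) β) * Complex.I)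
            * (inner ℝ ξ (combine (h.1 k) β) * Complex.I) ∂P
          - w.2.1 k * h.2.2 k * ‖ξ‖ ^ 2 / 2 * polytopeCharFun P ξ (w.1 k)) := by
  choose M hM hMa using fun k => exists_hasFDerivAt_polytopeCharFun hs ξ (w.1 k)
  have h1 : ∀ k : Fin K, HasFDerivAt (fun w : ParamSpace K d D => (w.2.1 k : ℂ))
      (Complex.ofRealCLM ∘L ContinuousLinearMap.proj k ∘L ContinuousLinearMap.fst ℝ _ _ ∘L
        ContinuousLinearMap.snd ℝ _ _) w := fun k =>
    ContinuousLinearMap.hasFDerivAt (Complex.ofRealCLM ∘L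
      (ContinuousLinearMap.proj (R := ℝ) (φ := fun _ : Fin K => ℝ) k) ∘L
        ContinuousLinearMap.fst ℝ (Fin K → ℝ) (Fin K → ℝ) ∘L
        ContinuousLinearMap.snd ℝ (Fin K → Fin d → EuclideanSpace ℝ (Fin D)) _)
  have h2 : ∀ k : Fin K, HasFDerivAt
      (fun w : ParamSpace K d D => (-(w.2.2 k * ‖ξ‖ ^ 2 / 2 : ℝ) : ℂ))
      ((-(‖ξ‖ ^ 2 / 2) : ℝ) • (Complex.ofRealCLM ∘L ContinuousLinearMap.proj k ∘L
        ContinuousLinearMap.snd ℝ _ _ ∘L ContinuousLinearMap.snd ℝ _ _)) w := fun k => by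
    have := ContinuousLinearMap.hasFDerivAt ((-(‖ξ‖ ^ 2 / 2) : ℝ) • (Complex.ofRealCLM ∘L
      (ContinuousLinearMap.proj (R := ℝ) (φ := fun _ : Fin K => ℝ) k) ∘L
        ContinuousLinearMap.snd ℝ (Fin K → ℝ) (Fin K → ℝ) ∘L
        ContinuousLinearMap.snd ℝ (Fin K → Fin d → EuclideanSpace ℝ (Fin D)) _)) (x := w)
    refine this.congr_of_eventuallyEq (Eventually.of_forall fun w => ?_)
    simp
    ring
  have h3 : ∀ k : Fin K, HasFDerivAt (fun w : ParamSpace K d D => polytopeCharFun P ξ (w.1 k))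
      (M k ∘L ContinuousLinearMap.proj k ∘L ContinuousLinearMap.fst ℝ _ _) w := fun k =>
    HasFDerivAt.comp (g := polytopeCharFun P ξ) (f := fun w : ParamSpace K d D => w.1 k) w (hM k)
      (ContinuousLinearMap.hasFDerivAt ((ContinuousLinearMap.proj (R := ℝ)
        (φ := fun _ : Fin K => Fin d → EuclideanSpace ℝ (Fin D)) k) ∘L
        ContinuousLinearMap.fst ℝ (Fin K → Fin d → EuclideanSpace ℝ (Fin D))
          ((Fin K → ℝ) × (Fin K → ℝ))))
  have h4 := fun k => (h1 k).mul
    (((Complex.hasDerivAt_exp _).comp_hasFDerivAt_of_eq w (h2 k) rfl).mul (h3 k))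
  refine ⟨_, HasFDerivAt.fun_sum fun k _ => h4 k, fun h => ?_⟩
  rw [sum_apply]
  refine Finset.sum_congr rfl fun k _ => ?_
  simp [hMa]
  ring

/-! ### Analytic continuation from Fourier to Laplace transforms -/

/-- The Laplace transform of a bounded variable with a bounded weight is entire. -/
theorem differentiable_integral_mul_cexp {Ω : Type*} [MeasurableSpace Ω] {P : Measure Ω}
    [IsProbabilityMeasure P] {g : Ω → ℂ} {X : Ω → ℝ} (hg : Measurable g) (hX : Measurable X)
    {A B : ℝ} (hgA : ∀ᵐ ω ∂P, ‖g ω‖ ≤ A) (hXB : ∀ᵐ ω ∂P, |X ω| ≤ B) :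
    Differentiable ℂ fun z : ℂ => ∫ ω, g ω * Complex.exp (z * X ω) ∂P := by
  intro z₀
  have hexp : ∀ ω, |X ω| ≤ B → ∀ z ∈ Metric.ball z₀ 1,
      ‖Complex.exp (z * X ω)‖ ≤ Real.exp ((‖z₀‖ + 1) * B) := by
    intro ω hω z hz
    refine (Complex.norm_exp_le_exp_norm _).trans (Real.exp_le_exp.2 ?_)
    rw [norm_mul, Complex.norm_real, Real.norm_eq_abs]
    have : ‖z‖ ≤ ‖z₀‖ + 1 := by
      have h1 := norm_le_norm_add_norm_sub' z z₀
      have h2 := mem_ball_iff_norm.1 hz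
      linarith
    gcongr
  refine (hasDerivAt_integral_of_dominated_loc_of_deriv_le (μ := P)
    (F := fun z ω => g ω * Complex.exp (z * X ω))
    (F' := fun z ω => g ω * (Complex.exp (z * X ω) * (1 * X ω)))
    (bound := fun _ => A * (Real.exp ((‖z₀‖ + 1) * B) * B))
    (Metric.ball_mem_nhds z₀ one_pos)
    (Eventually.of_forall fun z => (by fun_prop))
    ?_ (by fun_prop) ?_ (integrable_const _) ?_).2.differentiableAt
  · refine Integrable.of_bound (by fun_prop) (A * Real.exp ((‖z₀‖ + 1) * B)) ?_
    filter_upwards [hgA, hXB] with ω h1 h2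
    rw [norm_mul]
    have := hexp ω h2 z₀ (Metric.mem_ball_self one_pos)
    have := (norm_nonneg _).trans h1
    gcongr
  · filter_upwards [hgA, hXB] with ω h1 h2 z hz
    rw [norm_mul, norm_mul, one_mul, Complex.norm_real, Real.norm_eq_abs]
    have := hexp ω h2 z hz
    have := (norm_nonneg _).trans h1
    gcongr
  · refine Eventually.of_forall fun ω z _ => ?_
    exact (((hasDerivAt_id z).mul_const (X ω : ℂ)).cexp).const_mul (g ω)

/-- First-order identifiability: a direction of the parameter space along which the derivatives
of all values of the characteristic function vanish is zero. -/
theorem eq_zero_of_fourier_eq_zero (hD : 0 < D)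
    {P : Measure (EuclideanSpace ℝ (Fin d))} [IsProbabilityMeasure P]
    (hs : ∀ᵐ β ∂P, β ∈ simplex d) (hv : ∀ j, EuclideanSpace.single j 1 ∈ P.support)
    [Nonempty (Fin d)]
    {Θ : Fin K → Fin d → EuclideanSpace ℝ (Fin D)} {p v : Fin K → ℝ} (hp : ∀ k, 0 < p k)
    (hexp : TotallyExposed Θ) (hinj : ∀ k, Function.Injective (Θ k))
    {Δ : Fin K → Fin d → EuclideanSpace ℝ (Fin D)} {a s : Fin K → ℝ}
    (h : ∀ ξ : EuclideanSpace ℝ (Fin D),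
      ∑ k, Complex.exp (-(v k * ‖ξ‖ ^ 2 / 2 : ℝ)) * ((a k : ℂ) * polytopeCharFun P ξ (Θ k)
          + p k * ∫ β, Complex.exp (inner ℝ ξ (combine (Θ k) β) * Complex.I)
            * (inner ℝ ξ (combine (Δ k) β) * Complex.I) ∂P
          - p k * s k * ‖ξ‖ ^ 2 / 2 * polytopeCharFun P ξ (Θ k)) = 0) :
    Δ = 0 ∧ a = 0 ∧ s = 0 := by
  refine eq_zero_of_laplace_eq_zero hD hs hv (v := v) hp hexp hinj fun u t => ?_
  set X : Fin K → EuclideanSpace ℝ (Fin d) → ℝ := fun k β => ∑ i, β i * inner ℝ u (Θ k i) with hX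
  set Y : Fin K → EuclideanSpace ℝ (Fin d) → ℝ := fun k β => ∑ i, β i * inner ℝ u (Δ k i) with hY
  have hXm : ∀ k, Measurable (X k) := fun k => by fun_prop
  have hYm : ∀ k, Measurable (Y k) := fun k => by fun_prop
  have hXb : ∀ k, ∀ᵐ β ∂P, |X k β| ≤ ∑ i, |inner ℝ u (Θ k i)| := fun k => by
    filter_upwards [hs] with β hβ using abs_sum_mul_le_of_mem_simplex hβ _
  have hYb : ∀ k, ∀ᵐ β ∂P, |Y k β| ≤ ∑ i, |inner ℝ u (Δ k i)| := fun k => by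
    filter_upwards [hs] with β hβ using abs_sum_mul_le_of_mem_simplex hβ _
  set J : Fin K → ℂ → ℂ := fun k z => ∫ β, 1 * Complex.exp (z * X k β) ∂P with hJ
  set JY : Fin K → ℂ → ℂ := fun k z => ∫ β, (Y k β : ℂ) * Complex.exp (z * X k β) ∂P with hJY
  have hJd : ∀ k, Differentiable ℂ (J k) := fun k =>
    differentiable_integral_mul_cexp (A := 1) measurable_const (hXm k) (by simp) (hXb k)
  have hJYd : ∀ k, Differentiable ℂ (JY k) := fun k =>
    differentiable_integral_mul_cexp (by fun_prop) (hXm k)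
      (by simpa using hYb k) (hXb k)
  -- The directional derivative at `t • u`, continued analytically from `z = t * I`.
  set G : ℂ → ℂ := fun z => ∑ k, Complex.exp (v k * ‖u‖ ^ 2 / 2 * z ^ 2) *
    (a k * J k z + p k * (z * JY k z) + p k * s k * ‖u‖ ^ 2 / 2 * (z ^ 2 * J k z)) with hG
  have hGd : Differentiable ℂ G := by fun_prop
  have hGI : ∀ r : ℝ, G (r * Complex.I) = 0 := by
    intro r
    rw [← h (r • u)]
    refine Finset.sum_congr rfl fun k _ => ?_
    have e1 : ∀ (θ : Fin d → EuclideanSpace ℝ (Fin D)) β, (inner ℝ (r • u) (combine θ β) : ℝ)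
        = r * ∑ i, β i * inner ℝ u (θ i) := fun θ β => by
      rw [inner_smul_left, inner_combine]; rfl
    have e2 : ‖r • u‖ ^ 2 = r ^ 2 * ‖u‖ ^ 2 := by rw [norm_smul, mul_pow, Real.norm_eq_abs, sq_abs]
    have e3 : polytopeCharFun P (r • u) (Θ k) = J k (r * Complex.I) := by
      simp only [polytopeCharFun, hJ, e1, one_mul]
      congr 1 with β
      push_cast
      simp only [hX]
      push_cast
      ring_nf
    have e4 : ∫ β, Complex.exp (inner ℝ (r • u) (combine (Θ k) β) * Complex.I)
        * (inner ℝ (r • u) (combine (Δ k) β) * Complex.I) ∂P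
        = (r * Complex.I) * JY k (r * Complex.I) := by
      simp only [hJY, e1]
      rw [← integral_const_mul]
      congr 1 with β
      simp only [hX, hY]
      push_cast
      ring_nf
    have e5 : (((‖r • u‖ : ℝ) : ℂ)) ^ 2 = (r : ℂ) ^ 2 * (‖u‖ : ℂ) ^ 2 := by exact_mod_cast e2
    rw [e3, e4, e5, e2]
    push_cast
    congr 1
    · congr 1
      linear_combination ((v k : ℂ) * ‖u‖ ^ 2 / 2 * r ^ 2) * Complex.I_sq
    · linear_combination ((p k : ℂ) * s k * ‖u‖ ^ 2 / 2 * r ^ 2 * J k (r * Complex.I))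
        * Complex.I_sq
  -- `G` is entire and vanishes on the imaginary axis, hence also on the real axis.
  have hG0 : G = 0 := by
    refine AnalyticOnNhd.eq_of_frequently_eq (z₀ := 0)
      (Complex.analyticOnNhd_univ_iff_differentiable.2 hGd)
      (Complex.analyticOnNhd_univ_iff_differentiable.2 (differentiable_const 0)) ?_
    have htend : Tendsto (fun r : ℝ => (r : ℂ) * Complex.I) (𝓝[>] 0) (𝓝[≠] 0) := by
      refine tendsto_nhdsWithin_iff.2 ⟨?_, ?_⟩
      · have : ContinuousAt (fun r : ℝ => (r : ℂ) * Complex.I) 0 := by fun_prop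
        have := this.tendsto
        simp only [Complex.ofReal_zero, zero_mul] at this
        exact this.mono_left nhdsWithin_le_nhds
      · filter_upwards [self_mem_nhdsWithin] with r hr
        have : r ≠ 0 := ne_of_gt hr
        simpa using this
    exact htend.frequently (Eventually.of_forall fun r => hGI r).frequently
  have hGt : G t = 0 := by rw [hG0]; rfl
  have hbd : ∀ k, ∀ᵐ β ∂P, Real.exp (t * X k β)
      ≤ Real.exp (|t| * ∑ i, |inner ℝ u (Θ k i)|) := fun k => by
    filter_upwards [hXb k] with β hβ
    refine Real.exp_le_exp.2 ((le_abs_self _).trans ?_)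
    rw [abs_mul]
    gcongr
  have hi1 : ∀ k, Integrable (fun β => Real.exp (t * X k β)) P := fun k => by
    refine Integrable.of_bound (by fun_prop) (Real.exp (|t| * ∑ i, |inner ℝ u (Θ k i)|)) ?_
    filter_upwards [hbd k] with β hβ
    rwa [Real.norm_eq_abs, Real.abs_exp]
  have hi2 : ∀ k, Integrable (fun β => Y k β * Real.exp (t * X k β)) P := fun k =>
    (hi1 k).bdd_mul (hYm k).aestronglyMeasurable (by simpa using hYb k)
  have hJr : ∀ k, J k t = ((∫ β, Real.exp (t * X k β) ∂P : ℝ) : ℂ) := fun k => by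
    rw [← integral_complex_ofReal]
    simp [hJ]
  have hJYr : ∀ k, JY k t = ((∫ β, Y k β * Real.exp (t * X k β) ∂P : ℝ) : ℂ) := fun k => by
    rw [← integral_complex_ofReal]
    simp [hJY]
  have hsplit : ∀ k, ∫ β, (a k + t * ∑ i, β i * (p k * inner ℝ u (Δ k i))
        + t ^ 2 * (p k * s k * ‖u‖ ^ 2 / 2)) * Real.exp (t * ∑ i, β i * inner ℝ u (Θ k i)) ∂P
      = a k * ∫ β, Real.exp (t * X k β) ∂P + p k * (t * ∫ β, Y k β * Real.exp (t * X k β) ∂P)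
        + p k * s k * ‖u‖ ^ 2 / 2 * (t ^ 2 * ∫ β, Real.exp (t * X k β) ∂P) := by
    intro k
    have e : ∀ β : EuclideanSpace ℝ (Fin d), (a k + t * ∑ i, β i * (p k * inner ℝ u (Δ k i))
        + t ^ 2 * (p k * s k * ‖u‖ ^ 2 / 2)) * Real.exp (t * ∑ i, β i * inner ℝ u (Θ k i))
        = (a k + p k * s k * ‖u‖ ^ 2 / 2 * t ^ 2) * Real.exp (t * X k β)
          + (p k * t) * (Y k β * Real.exp (t * X k β)) := fun β => by
      have : ∑ i, β i * (p k * inner ℝ u (Δ k i)) = p k * Y k β := by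
        simp only [hY, Finset.mul_sum]
        exact Finset.sum_congr rfl fun i _ => by ring
      rw [this]
      simp only [hX]
      ring
    simp only [e]
    rw [integral_add ((hi1 k).const_mul _) ((hi2 k).const_mul _), integral_const_mul,
      integral_const_mul]
    ring
  have : ((∑ k, Real.exp (v k * ‖u‖ ^ 2 / 2 * t ^ 2) * ∫ β, (a k
        + t * ∑ i, β i * (p k * inner ℝ u (Δ k i)) + t ^ 2 * (p k * s k * ‖u‖ ^ 2 / 2))
        * Real.exp (t * ∑ i, β i * inner ℝ u (Θ k i)) ∂P : ℝ) : ℂ) = 0 := by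
    rw [← hGt]
    simp only [hsplit, hG, hJr, hJYr]
    push_cast
    rfl
  exact_mod_cast this

/-! ### Total variation controls the characteristic function -/

theorem integral_abs_sub_le_tvDist {X : Type*} [MeasurableSpace X] {μ : Measure X}
    {f g : X → ℝ} (hf : Integrable f μ) (hg : Integrable g μ) (hf0 : 0 ≤ f) (hg0 : 0 ≤ g)
    (hfm : Measurable f) (hgm : Measurable g) :
    ∫ x, |f x - g x| ∂μ ≤ 2 * tvDist (μ.withDensity fun x => ENNReal.ofReal (f x))
      (μ.withDensity fun x => ENNReal.ofReal (g x)) := by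
  have hreal : ∀ {f : X → ℝ}, Integrable f μ → 0 ≤ f → ∀ A, MeasurableSet A →
      (μ.withDensity fun x => ENNReal.ofReal (f x)).real A = ∫ x in A, f x ∂μ := by
    intro f hf hf0 A hA
    rw [Measure.real, withDensity_apply _ hA, ← ofReal_integral_eq_lintegral_ofReal hf.integrableOn
      (Eventually.of_forall hf0), ENNReal.toReal_ofReal (integral_nonneg hf0)]
  set ν := μ.withDensity fun x => ENNReal.ofReal (f x)
  set ρ := μ.withDensity fun x => ENNReal.ofReal (g x)
  have hbdd : BddAbove (Set.range fun A : {A : Set X // MeasurableSet A} =>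
      |ν.real A - ρ.real A|) := by
    refine ⟨∫ x, |f x - g x| ∂μ, ?_⟩
    rintro _ ⟨A, rfl⟩
    simp only [ν, ρ, hreal hf hf0 A A.2, hreal hg hg0 A A.2]
    rw [← integral_sub hf.integrableOn hg.integrableOn]
    exact (abs_integral_le_integral_abs).trans (setIntegral_le_integral (hf.sub hg).abs
      (Eventually.of_forall fun x => abs_nonneg _))
  have hle : ∀ A, MeasurableSet A → |∫ x in A, f x ∂μ - ∫ x in A, g x ∂μ| ≤ tvDist ν ρ := by
    intro A hA
    rw [← hreal hf hf0 A hA, ← hreal hg hg0 A hA]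
    exact le_ciSup hbdd (⟨A, hA⟩ : {A : Set X // MeasurableSet A})
  set S : Set X := {x | g x ≤ f x} with hS
  have hSm : MeasurableSet S := measurableSet_le hgm hfm
  have h1 := (le_abs_self _).trans (hle S hSm)
  have h2 := (neg_le_abs _).trans (hle Sᶜ hSm.compl)
  rw [← integral_sub hf.integrableOn hg.integrableOn] at h1 h2
  have h3 : ∫ x in S, |f x - g x| ∂μ = ∫ x in S, (f x - g x) ∂μ :=
    setIntegral_congr_fun hSm fun x hx => abs_of_nonneg (sub_nonneg.2 hx)
  have h4 : ∫ x in Sᶜ, |f x - g x| ∂μ = -∫ x in Sᶜ, (f x - g x) ∂μ := by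
    rw [← integral_neg]
    exact setIntegral_congr_fun hSm.compl fun x hx =>
      abs_of_nonpos (sub_nonpos.2 (not_le.1 (show ¬ g x ≤ f x from hx)).le)
  have h5 := integral_add_compl hSm (hf.sub hg).abs
  simp only [Pi.sub_apply] at h5
  rw [← h5, h3, h4]
  linarith

theorem gaussianDensity_nonneg {m : EuclideanSpace ℝ (Fin D)} {v : ℝ} (hv : 0 < v)
    (x : EuclideanSpace ℝ (Fin D)) : 0 ≤ gaussianDensity m v x := by
  unfold gaussianDensity
  positivity

theorem integral_gaussianDensity_mul_cexp (m : EuclideanSpace ℝ (Fin D)) {v : ℝ} (hv : 0 < v)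
    (ξ : EuclideanSpace ℝ (Fin D)) :
    ∫ x, (gaussianDensity m v x : ℂ) * Complex.exp (inner ℝ ξ x * Complex.I)
      = Complex.exp (-(v * ‖ξ‖ ^ 2 / 2 : ℝ)) * Complex.exp (inner ℝ ξ m * Complex.I) := by
  rw [← integral_add_right_eq_self _ m]
  have hb : 0 < ((1 / (2 * v) : ℝ) : ℂ).re := by rw [Complex.ofReal_re]; positivity
  have key := GaussianFourier.integral_cexp_neg_mul_sq_norm_add hb Complex.I ξ
  have e : ∀ x : EuclideanSpace ℝ (Fin D), (gaussianDensity m v (x + m) : ℂ) *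
      Complex.exp (inner ℝ ξ (x + m) * Complex.I)
      = (((2 * Real.pi * v) ^ (-(D : ℝ) / 2) : ℝ) * Complex.exp (inner ℝ ξ m * Complex.I)) *
        Complex.exp (-((1 / (2 * v) : ℝ) : ℂ) * ‖x‖ ^ 2 + Complex.I * inner ℝ ξ x) := by
    intro x
    rw [gaussianDensity, add_sub_cancel_right, inner_add_right, Complex.ofReal_mul,
      Complex.ofReal_exp]
    generalize (2 * Real.pi * v) ^ (-(D : ℝ) / 2) = c
    rw [mul_assoc, mul_assoc, ← Complex.exp_add, ← Complex.exp_add]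
    congr 2
    push_cast
    field_simp
    ring
  simp only [e]
  rw [integral_const_mul, key, finrank_euclideanSpace, Fintype.card_fin]
  have hpos : (0 : ℝ) < 2 * Real.pi * v := by positivity
  have e1 : ((Real.pi : ℂ) / ((1 / (2 * v) : ℝ) : ℂ)) ^ ((D : ℂ) / 2)
      = (((2 * Real.pi * v) ^ ((D : ℝ) / 2) : ℝ) : ℂ) := by
    rw [Complex.ofReal_cpow hpos.le]
    congr 1
    · push_cast; field_simp
    · push_cast; rfl
  have e2 : ((2 * Real.pi * v) ^ (-(D : ℝ) / 2) : ℝ) * ((2 * Real.pi * v) ^ ((D : ℝ) / 2) : ℝ)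
      = 1 := by
    rw [← Real.rpow_add hpos, neg_div, neg_add_cancel, Real.rpow_zero]
  have e3 : Complex.I ^ 2 * (‖ξ‖ : ℂ) ^ 2 / (4 * ((1 / (2 * v) : ℝ) : ℂ))
      = ((-(v * ‖ξ‖ ^ 2 / 2) : ℝ) : ℂ) := by
    rw [Complex.I_sq]
    push_cast
    field_simp
    ring
  have e2' : (((2 * Real.pi * v) ^ (-(D : ℝ) / 2) : ℝ) : ℂ) *
      (((2 * Real.pi * v) ^ ((D : ℝ) / 2) : ℝ) : ℂ) = 1 := by exact_mod_cast e2
  rw [e1, e3]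
  push_cast at e2' ⊢
  linear_combination (Complex.exp (inner ℝ ξ m * Complex.I) *
    Complex.exp (-(v * ‖ξ‖ ^ 2 / 2))) * e2'

theorem integrable_gaussianDensity (m : EuclideanSpace ℝ (Fin D)) {v : ℝ} (hv : 0 < v) :
    Integrable (gaussianDensity m v) := by
  -- Otherwise the total integral would take the junk value `0` instead of `1`.
  by_contra h
  have h1 := integral_gaussianDensity_mul_cexp m hv 0
  simp only [inner_zero_left, Complex.ofReal_zero, zero_mul, Complex.exp_zero, mul_one] at h1
  rw [integral_undef (fun hc => h (by simpa using hc.re))] at h1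
  simp at h1

theorem integral_gaussianDensity (m : EuclideanSpace ℝ (Fin D)) {v : ℝ} (hv : 0 < v) :
    ∫ x, gaussianDensity m v x = 1 := by
  have h1 := integral_gaussianDensity_mul_cexp m hv 0
  simp only [inner_zero_left, Complex.ofReal_zero, zero_mul, Complex.exp_zero, mul_one] at h1
  rw [integral_complex_ofReal] at h1
  simpa using h1

theorem continuous_prod_gaussianDensity (θ : Fin d → EuclideanSpace ℝ (Fin D)) (v : ℝ) :
    Continuous fun z : EuclideanSpace ℝ (Fin D) × EuclideanSpace ℝ (Fin d) =>
      gaussianDensity (combine θ z.2) v z.1 := by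
  unfold gaussianDensity combine
  fun_prop

theorem integrable_prod_gaussianDensity (P : Measure (EuclideanSpace ℝ (Fin d)))
    [IsProbabilityMeasure P] (θ : Fin d → EuclideanSpace ℝ (Fin D)) {v : ℝ} (hv : 0 < v) :
    Integrable (fun z : EuclideanSpace ℝ (Fin D) × EuclideanSpace ℝ (Fin d) =>
      gaussianDensity (combine θ z.2) v z.1)
      ((volume : Measure (EuclideanSpace ℝ (Fin D))).prod P) := by
  refine (integrable_prod_iff'
    (continuous_prod_gaussianDensity θ v).aestronglyMeasurable).2 ⟨?_, ?_⟩
  · exact Eventually.of_forall fun β => integrable_gaussianDensity (combine θ β) hv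
  · refine (integrable_const (1 : ℝ)).congr (Eventually.of_forall fun β => ?_)
    simp only [Real.norm_of_nonneg (gaussianDensity_nonneg hv _)]
    exact (integral_gaussianDensity (combine θ β) hv).symm

theorem integral_mul_cexp_component (P : Measure (EuclideanSpace ℝ (Fin d)))
    [IsProbabilityMeasure P] (θ : Fin d → EuclideanSpace ℝ (Fin D)) {v : ℝ} (hv : 0 < v)
    (ξ : EuclideanSpace ℝ (Fin D)) :
    ∫ x, ((∫ β, gaussianDensity (combine θ β) v x ∂P : ℝ) : ℂ)
        * Complex.exp (inner ℝ ξ x * Complex.I)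
      = Complex.exp (-(v * ‖ξ‖ ^ 2 / 2 : ℝ)) * polytopeCharFun P ξ θ := by
  have hI : Integrable (fun z : EuclideanSpace ℝ (Fin D) × EuclideanSpace ℝ (Fin d) =>
      (gaussianDensity (combine θ z.2) v z.1 : ℂ)) (volume.prod P) :=
    (integrable_prod_gaussianDensity P θ hv).ofReal
  have hI2 : Integrable (fun z : EuclideanSpace ℝ (Fin D) × EuclideanSpace ℝ (Fin d) =>
      (gaussianDensity (combine θ z.2) v z.1 : ℂ) * Complex.exp (inner ℝ ξ z.1 * Complex.I))
      ((volume : Measure (EuclideanSpace ℝ (Fin D))).prod P) := by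
    refine hI.mono (hI.aestronglyMeasurable.mul (Continuous.aestronglyMeasurable
      (by fun_prop))) (Eventually.of_forall fun z => ?_)
    rw [norm_mul, Complex.norm_exp_ofReal_mul_I, mul_one]
  simp only [← integral_complex_ofReal, ← integral_mul_const]
  rw [integral_integral_swap (f := fun (x : EuclideanSpace ℝ (Fin D))
    (β : EuclideanSpace ℝ (Fin d)) => (gaussianDensity (combine θ β) v x : ℂ)
      * Complex.exp (inner ℝ ξ x * Complex.I)) hI2]
  simp only [integral_gaussianDensity_mul_cexp _ hv]
  rw [integral_const_mul, polytopeCharFun]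

theorem integrable_component (P : Measure (EuclideanSpace ℝ (Fin d)))
    [IsProbabilityMeasure P] (θ : Fin d → EuclideanSpace ℝ (Fin D)) {v : ℝ} (hv : 0 < v) :
    Integrable (fun x => ∫ β, gaussianDensity (combine θ β) v x ∂P) :=
  (integrable_prod_gaussianDensity P θ hv).integral_prod_left

theorem integrable_density (P : Measure (EuclideanSpace ℝ (Fin d))) [IsProbabilityMeasure P]
    (ψ : Param K d D) : Integrable (density P ψ) :=
  integrable_finsetSum _ fun k _ => (integrable_component P (ψ.Θ k) (ψ.var_pos k)).const_mul _

theorem density_nonneg (P : Measure (EuclideanSpace ℝ (Fin d))) (ψ : Param K d D) :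
    0 ≤ density P ψ := fun _ =>
  Finset.sum_nonneg fun k _ => mul_nonneg (ψ.weight_pos k).le
    (integral_nonneg fun _ => gaussianDensity_nonneg (ψ.var_pos k) _)

theorem measurable_density (P : Measure (EuclideanSpace ℝ (Fin d))) [IsProbabilityMeasure P]
    (ψ : Param K d D) : Measurable (density P ψ) :=
  Finset.measurable_fun_sum _ fun k _ => Measurable.const_mul
    (continuous_prod_gaussianDensity (ψ.Θ k)
      (ψ.var k)).stronglyMeasurable.integral_prod_right.measurable _

/-- The coordinates of a parameter in the ambient linear space. -/
def Param.toSpace (ψ : Param K d D) : ParamSpace K d D := (ψ.Θ, ψ.weight, ψ.var)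

theorem integral_density_mul_cexp (P : Measure (EuclideanSpace ℝ (Fin d)))
    [IsProbabilityMeasure P] (ψ : Param K d D) (ξ : EuclideanSpace ℝ (Fin D)) :
    ∫ x, (density P ψ x : ℂ) * Complex.exp (inner ℝ ξ x * Complex.I)
      = mixtureCharFun P ξ ψ.toSpace := by
  simp only [density, Complex.ofReal_sum, Complex.ofReal_mul, Finset.sum_mul, mul_assoc]
  rw [integral_finsetSum]
  · refine Finset.sum_congr rfl fun k _ => ?_
    rw [integral_const_mul, integral_mul_cexp_component P (ψ.Θ k) (ψ.var_pos k)]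
    rfl
  · intro k _
    refine Integrable.const_mul ?_ _
    refine ((integrable_component P (ψ.Θ k) (ψ.var_pos k)).ofReal (𝕜 := ℂ)).mul_bdd (c := 1) ?_ ?_
    · exact Continuous.aestronglyMeasurable (by fun_prop)
    · exact Eventually.of_forall fun z => (Complex.norm_exp_ofReal_mul_I _).le

/-- The total variation distance dominates differences of characteristic functions. -/
theorem norm_mixtureCharFun_sub_le (P : Measure (EuclideanSpace ℝ (Fin d)))
    [IsProbabilityMeasure P] (ψ ψ' : Param K d D) (ξ : EuclideanSpace ℝ (Fin D)) :
    ‖mixtureCharFun P ξ ψ.toSpace - mixtureCharFun P ξ ψ'.toSpace‖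
      ≤ 2 * tvDist (law P ψ) (law P ψ') := by
  have hint : ∀ ψ : Param K d D, Integrable fun x =>
      (density P ψ x : ℂ) * Complex.exp (inner ℝ ξ x * Complex.I) := fun ψ => by
    refine ((integrable_density P ψ).ofReal (𝕜 := ℂ)).mul_bdd (c := 1) ?_ ?_
    · exact Continuous.aestronglyMeasurable (by fun_prop)
    · exact Eventually.of_forall fun z => (Complex.norm_exp_ofReal_mul_I _).le
  rw [← integral_density_mul_cexp, ← integral_density_mul_cexp, ← integral_sub (hint ψ) (hint ψ')]
  refine (norm_integral_le_integral_norm _).trans (le_trans (le_of_eq ?_)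
    (integral_abs_sub_le_tvDist (integrable_density P ψ) (integrable_density P ψ')
      (density_nonneg P ψ) (density_nonneg P ψ') (measurable_density P ψ)
      (measurable_density P ψ')))
  congr 1 with x
  rw [← sub_mul, norm_mul, Complex.norm_exp_ofReal_mul_I, mul_one, ← Complex.ofReal_sub,
    Complex.norm_real, Real.norm_eq_abs]

/-! ### Relabelling and the linear lower bound -/

theorem polytopeCharFun_comp_perm {P : Measure (EuclideanSpace ℝ (Fin d))} (hP : Exchangeable P)
    (ξ : EuclideanSpace ℝ (Fin D)) (θ : Fin d → EuclideanSpace ℝ (Fin D))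
    (σ : Equiv.Perm (Fin d)) :
    polytopeCharFun P ξ (fun j => θ (σ j)) = polytopeCharFun P ξ θ := by
  have hc : Continuous fun β : EuclideanSpace ℝ (Fin d) =>
      (WithLp.toLp 2 (fun j => β (σ⁻¹ j)) : EuclideanSpace ℝ (Fin d)) := by fun_prop
  have hcomb : ∀ β : EuclideanSpace ℝ (Fin d), combine (fun j => θ (σ j)) β
      = combine θ (WithLp.toLp 2 (fun j => β (σ⁻¹ j))) := fun β => by
    simp only [combine]
    exact Fintype.sum_equiv σ _ _ fun j => by simp
  have hcont := continuous_inner_combine ξ θ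
  conv_rhs => rw [polytopeCharFun, ← hP σ⁻¹]
  rw [integral_map hc.measurable.aemeasurable
    (Continuous.aestronglyMeasurable (by fun_prop)), polytopeCharFun]
  simp only [hcomb]

/-- Relabelling the components and end-members of `ψ` by permutations that attain the minima in
`paramDist ψ ψ₀` leaves the characteristic functions unchanged, by exchangeability, and turns
`paramDist` into a norm-like distance. -/
theorem exists_relabel {P : Measure (EuclideanSpace ℝ (Fin d))} (hP : Exchangeable P)
    (ψ ψ₀ : Param K d D) :
    ∃ w : ParamSpace K d D, (∀ ξ, mixtureCharFun P ξ w = mixtureCharFun P ξ ψ.toSpace) ∧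
      paramDist ψ ψ₀ = ∑ k, (∑ j, ‖w.1 k j - ψ₀.Θ k j‖ + |w.2.1 k - ψ₀.weight k|
        + |w.2.2 k - ψ₀.var k|) := by
  obtain ⟨τ, hτ⟩ := exists_eq_ciInf_of_finite (f := fun τ : Equiv.Perm (Fin K) => ∑ k,
    (endmemberDist (ψ.Θ k) (ψ₀.Θ (τ k)) + |ψ.weight k - ψ₀.weight (τ k)|
      + |ψ.var k - ψ₀.var (τ k)|))
  choose ρ hρ using fun k => exists_eq_ciInf_of_finite (f := fun ρ : Equiv.Perm (Fin d) =>
    ∑ j, ‖ψ.Θ k j - ψ₀.Θ (τ k) (ρ j)‖)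
  refine ⟨(fun k j => ψ.Θ (τ⁻¹ k) ((ρ (τ⁻¹ k))⁻¹ j), fun k => ψ.weight (τ⁻¹ k),
    fun k => ψ.var (τ⁻¹ k)), fun ξ => ?_, ?_⟩
  · simp only [mixtureCharFun, Param.toSpace, polytopeCharFun_comp_perm hP]
    exact Fintype.sum_equiv τ⁻¹ _ _ fun k => rfl
  · rw [paramDist, ← hτ]
    refine Fintype.sum_equiv τ _ _ fun k => ?_
    have hk : τ⁻¹ (τ k) = k := by simp
    simp only [hk]
    rw [endmemberDist, ← hρ k]
    congr 2
    exact Fintype.sum_equiv (ρ k) _ _ fun j => by simp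

/-- A family of differentiable functions whose derivatives at `w₀` have no common kernel separates
`w₀` from nearby points at a linear rate. -/
theorem exists_eventually_mul_norm_sub_le {V ι : Type*} [NormedAddCommGroup V] [NormedSpace ℝ V]
    [FiniteDimensional ℝ V] {F : ι → V → ℂ} {L : ι → V →L[ℝ] ℂ} {w₀ : V}
    (hF : ∀ i, HasFDerivAt (F i) (L i) w₀) (hL : ∀ h, (∀ i, L i h = 0) → h = 0) :
    ∃ c > 0, ∀ᶠ w in 𝓝 w₀, ∀ T, 0 ≤ T → (∀ i, ‖F i w - F i w₀‖ ≤ T) → c * ‖w - w₀‖ ≤ T := by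
  -- By compactness of the unit sphere, finitely many members of the family suffice.
  obtain ⟨t, ht⟩ := (isCompact_sphere (0 : V) 1).elim_finite_subcover
    (fun i => {h | L i h ≠ 0}) (fun i => isOpen_ne_fun (L i).continuous continuous_const)
    (fun h hh => by
      by_contra hc
      have h0 : h = 0 := hL h fun i => by
        by_contra hi
        exact hc (Set.mem_iUnion.2 ⟨i, hi⟩)
      simp [h0] at hh)
  have hΦ : HasFDerivAt (fun w (i : t) => F i w) (ContinuousLinearMap.pi fun i : t => L i) w₀ :=
    hasFDerivAt_pi.2 fun i => hF i
  have hinj : LinearMap.ker (ContinuousLinearMap.pi fun i : t => L i : V →L[ℝ] (t → ℂ)).toLinearMap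
      = ⊥ := by
    refine LinearMap.ker_eq_bot'.2 fun h hh => ?_
    by_contra hne
    have hn : ‖h‖ ≠ 0 := norm_ne_zero_iff.2 hne
    have hmem : ‖h‖⁻¹ • h ∈ Metric.sphere (0 : V) 1 := by
      simp [norm_smul, hn]
    obtain ⟨i, hi, hi2⟩ := Set.mem_iUnion₂.1 (ht hmem)
    apply hi2
    have : L i h = 0 := congrFun hh ⟨i, hi⟩
    rw [map_smul, this, smul_zero]
  have hO := (hΦ.isTheta_sub (LinearMap.isClosedEmbedding_of_injective hinj).isInducing).isBigO_symm
  obtain ⟨C, hC, hCb⟩ := hO.exists_pos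
  refine ⟨C⁻¹, inv_pos.2 hC, ?_⟩
  filter_upwards [hCb.bound] with w hw T hT hFT
  have h1 : ‖(fun i : t => F i w) - fun i : t => F i w₀‖ ≤ T :=
    (pi_norm_le_iff_of_nonneg hT).2 fun i => hFT i
  rw [inv_mul_le_iff₀ hC]
  exact hw.trans (by gcongr)

theorem tvDist_nonneg {X : Type*} [MeasurableSpace X] (μ ν : Measure X) : 0 ≤ tvDist μ ν :=
  Real.iSup_nonneg fun _ => abs_nonneg _

end PolytopeMixture

/-! ### Lower bound on the total variation distance -/

open PolytopeMixture in
theorem theorem4p4 {K d D : ℕ} (hD : 0 < D)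
    (Pβ : Measure (EuclideanSpace ℝ (Fin d))) [IsProbabilityMeasure Pβ]
    (hac : Pβ ≪ (μH[(d : ℝ) - 1]).restrict (PolytopeMixture.simplex d))
    (hsupp : Pβ.support = PolytopeMixture.simplex d)
    (hexch : PolytopeMixture.Exchangeable Pβ)
    (ψ₀ : PolytopeMixture.Param K d D)
    (hdistinct : ∀ k, Function.Injective (ψ₀.Θ k))
    (hexp : PolytopeMixture.TotallyExposed ψ₀.Θ) :
    0 < Filter.liminf
      (fun ψ : PolytopeMixture.Param K d D =>
        ENNReal.ofReal
          (PolytopeMixture.tvDist (PolytopeMixture.law Pβ ψ) (PolytopeMixture.law Pβ ψ₀)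
            / PolytopeMixture.paramDist ψ ψ₀))
      (Filter.comap (fun ψ : PolytopeMixture.Param K d D => PolytopeMixture.paramDist ψ ψ₀)
        (𝓝[>] (0 : ℝ))) := by
  have hs : ∀ᵐ β ∂Pβ, β ∈ simplex d := hsupp ▸ Measure.support_mem_ae
  have hv : ∀ j, EuclideanSpace.single j 1 ∈ Pβ.support := by
    intro j
    rw [hsupp]
    refine ⟨fun i => ?_, by simp⟩
    by_cases hij : i = j <;> simp [hij]
  have : Nonempty (Fin d) := by
    obtain ⟨β, hβ⟩ := hs.exists
    by_contra hne
    rw [not_nonempty_iff] at hne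
    simpa using hβ.2
  choose L hL hLa using fun ξ => exists_hasFDerivAt_mixtureCharFun hs ξ ψ₀.toSpace
  obtain ⟨c, hc, hev⟩ := exists_eventually_mul_norm_sub_le hL fun h hh => by
    obtain ⟨h1, h2, h3⟩ := eq_zero_of_fourier_eq_zero hD hs hv ψ₀.weight_pos hexp hdistinct
      fun ξ => (hLa ξ h).symm.trans (hh ξ)
    exact Prod.ext h1 (Prod.ext h2 h3)
  obtain ⟨δ, hδ, hball⟩ := Metric.eventually_nhds_iff.1 hev
  set M : ℝ := K * (d + 2) + 1 with hM
  have hMpos : 0 < M := by positivity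
  have hbound : ∀ᶠ ψ : Param K d D in comap (fun ψ => paramDist ψ ψ₀) (𝓝[>] (0 : ℝ)),
      ENNReal.ofReal (c / (2 * M)) ≤
        ENNReal.ofReal (tvDist (law Pβ ψ) (law Pβ ψ₀) / paramDist ψ ψ₀) := by
    have hmem : ∀ᶠ r in 𝓝[>] (0 : ℝ), r ∈ Set.Ioo 0 δ := Ioo_mem_nhdsGT hδ
    filter_upwards [hmem.comap _] with ψ hψ
    obtain ⟨w, hw, hdist⟩ := exists_relabel hexch ψ ψ₀
    set r := paramDist ψ ψ₀
    have hnn : ∀ k, 0 ≤ ∑ j, ‖w.1 k j - ψ₀.Θ k j‖ + |w.2.1 k - ψ₀.weight k|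
        + |w.2.2 k - ψ₀.var k| := fun k => by positivity
    have hk : ∀ k, ∑ j, ‖w.1 k j - ψ₀.Θ k j‖ + |w.2.1 k - ψ₀.weight k|
        + |w.2.2 k - ψ₀.var k| ≤ r := fun k => by
      rw [hdist]
      exact Finset.single_le_sum (fun k _ => hnn k) (Finset.mem_univ k)
    have hr : 0 ≤ r := hψ.1.le
    have hle : ‖w - ψ₀.toSpace‖ ≤ r := by
      refine norm_prod_le_iff.2 ⟨?_, norm_prod_le_iff.2 ⟨?_, ?_⟩⟩
      · refine (pi_norm_le_iff_of_nonneg hr).2 fun k => (pi_norm_le_iff_of_nonneg hr).2 fun j => ?_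
        have h1 : ‖w.1 k j - ψ₀.Θ k j‖ ≤ ∑ j, ‖w.1 k j - ψ₀.Θ k j‖ :=
          Finset.single_le_sum (f := fun j => ‖w.1 k j - ψ₀.Θ k j‖)
            (fun j _ => norm_nonneg _) (Finset.mem_univ j)
        have := hk k
        have := abs_nonneg (w.2.1 k - ψ₀.weight k)
        have := abs_nonneg (w.2.2 k - ψ₀.var k)
        change ‖w.1 k j - ψ₀.Θ k j‖ ≤ r
        linarith
      · refine (pi_norm_le_iff_of_nonneg hr).2 fun k => ?_
        have h1 : 0 ≤ ∑ j, ‖w.1 k j - ψ₀.Θ k j‖ := by positivity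
        have := hk k
        have := abs_nonneg (w.2.2 k - ψ₀.var k)
        change |w.2.1 k - ψ₀.weight k| ≤ r
        linarith
      · refine (pi_norm_le_iff_of_nonneg hr).2 fun k => ?_
        have h1 : 0 ≤ ∑ j, ‖w.1 k j - ψ₀.Θ k j‖ := by positivity
        have := hk k
        have := abs_nonneg (w.2.1 k - ψ₀.weight k)
        change |w.2.2 k - ψ₀.var k| ≤ r
        linarith
    -- Converse comparison: `r` is a sum of `K * (d + 2)` norms of coordinates.
    have hge : r ≤ M * ‖w - ψ₀.toSpace‖ := by
      set N := ‖w - ψ₀.toSpace‖ with hN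
      have hN0 : 0 ≤ N := norm_nonneg _
      have n1 : ∀ k j, ‖w.1 k j - ψ₀.Θ k j‖ ≤ N := fun k j =>
        (norm_le_pi_norm ((w - ψ₀.toSpace).1 k) j).trans
          ((norm_le_pi_norm (w - ψ₀.toSpace).1 k).trans (norm_fst_le _))
      have n2 : ∀ k, |w.2.1 k - ψ₀.weight k| ≤ N := fun k =>
        (norm_le_pi_norm (w - ψ₀.toSpace).2.1 k).trans
          ((norm_fst_le _).trans (norm_snd_le (w - ψ₀.toSpace)))
      have n3 : ∀ k, |w.2.2 k - ψ₀.var k| ≤ N := fun k =>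
        (norm_le_pi_norm (w - ψ₀.toSpace).2.2 k).trans
          ((norm_snd_le _).trans (norm_snd_le (w - ψ₀.toSpace)))
      calc r ≤ ∑ _k : Fin K, (∑ _j : Fin d, N + N + N) := by
            rw [hdist]
            gcongr with k _ j _
            · exact n1 k j
            · exact n2 k
            · exact n3 k
        _ = (K * (d + 2)) * N := by
            simp only [Finset.sum_const, Finset.card_univ, Fintype.card_fin, nsmul_eq_mul]
            ring
        _ ≤ M * N := by gcongr; linarith
    have htv := hball (y := w) (by rw [dist_eq_norm]; exact hle.trans_lt hψ.2)
      (2 * tvDist (law Pβ ψ) (law Pβ ψ₀)) (mul_nonneg two_pos.le (tvDist_nonneg _ _))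
      (fun ξ => by rw [hw ξ]; exact norm_mixtureCharFun_sub_le Pβ ψ ψ₀ ξ)
    refine ENNReal.ofReal_le_ofReal ?_
    rw [div_le_div_iff₀ (by positivity) hψ.1]
    calc c * r ≤ c * (M * ‖w - ψ₀.toSpace‖) := by gcongr
      _ = M * (c * ‖w - ψ₀.toSpace‖) := by ring
      _ ≤ M * (2 * tvDist (law Pβ ψ) (law Pβ ψ₀)) := by gcongr
      _ = _ := by ring
  exact lt_of_lt_of_le (ENNReal.ofReal_pos.2 (by positivity))
    (le_liminf_of_le (by isBoundedDefault) hbound)
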